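/- Let $\mathcal X\subset\mathbb R^{d_X}$, $\mathcal Y\subset\mathbb R^{d_Y}$ ($d_X,d_Y\ge1$) be compact convex sets with $\|x-x'\|\le D_{\mathcal X}$ and $\|y-y'\|\le D_{\mathcal Y}$ for all $x,x'\in\mathcal X$, $y,y'\in\mathcal Y$. Let $\xi$ be a random element with law $P$, and for $t=1,\dots,T$ let $F_t(x,y,\xi)$ be a measurable random function on $\mathbb R^{d_X}\times\mathbb R^{d_Y}$, with mean $f_t(x,y)=\mathbf E_\xi F_t(x,y,\xi)$, such that 1. $F_t(\cdot,\cdot,\xi)$ is continuously differentiable in $x$ and in $y$, $\mu_X$-strongly convex in $x\in\mathcal X$ for each $y\in\mathcal Y$, and $\mu_Y$-strongly concave in $y\in\mathcal Y$ for each $x\in\mathcal X$ ($\mu_X,\mu_Y>0$); 2. almost surely, $F_t$ is $L_X$-Lipschitz in $x$ and $L_Y$-Lipschitz in $y$ on $\mathcal X\times\mathcal Y$; 3. almost surely, $\nabla_xF_t(\cdot,y,\xi)$ is $L_{GX}$-Lipschitz on $\mathbb R^{d_X}$ for each $y\in\mathcal Y$, and $\nabla_yF_t(x,\cdot,\xi)$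 is $L_{GY}$-Lipschitz on $\mathbb R^{d_Y}$ for each $x\in\mathcal X$; 4. almost surely, $\nabla_xF_t(x,\cdot,\xi)$ is $L_{XY}$-Lipschitz on $\mathcal Y$ for each $x\in\mathcal X$, and $\nabla_yF_t(\cdot,y,\xi)$ is $L_{YX}$-Lipschitz on $\mathcal X$ for each $y\in\mathcal Y$; 5. on $\mathcal X\times\mathcal Y$, $F_t(x,y,\xi)$ is integrable, $\mathbf E\nabla_{x}F_t=\nabla_{x}f_t$ and $\mathbf E\|\nabla_{x}F_t-\nabla_{x}f_t\|^2\le\sigma^2$, and likewise for $\nabla_y$. Let $(x_t^*,y_t^*)$ be the saddle point of $f_t$ on $\mathcal X\times\mathcal Y$. Assume that it is interior, with $\mathrm{dist}(x_t^*,\partial\mathcal X)\ge\delta_{\mathcal X}>0$ and $\mathrm{dist}(y_t^*,\partial\mathcal Y)\ge\delta_{\mathcal Y}>0$ for all $t$. Assume that $$\sum_{t=1}^{T-1}\big(\|x_{t+1}^*-x_t^*\|^2+\|y_{t+1}^*-y_t^*\|^2\big)\le V_T,\qquad \sum_{t=1}^{T-1}\ \sup_{\mathcal X\times\mathcal Y}|f_t-f_{t+1}|\le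 W_T,$$ and that $0\le C_0\le1$, where $$C_0=1-\frac{\sqrt2}{\delta_\mu}\max\Big\{\frac{D_{\mathcal X}L_{XY}}{\sqrt{\mu_Y}},\frac{D_{\mathcal Y}L_{YX}}{\sqrt{\mu_X}}\Big\},\qquad \delta_\mu=\sqrt{\min(\mu_X\delta_{\mathcal X}^2,\mu_Y\delta_{\mathcal Y}^2)} .$$ Put $M_T=\max(2W_T,V_T)$. Let $\kappa>0$ and assume $0<M_T\le T$ and $M_T+\sigma^2\ge\kappa$. Consider the Frank–Wolfe method: start at any $z_1=(x_1,y_1)\in\mathcal X\times\mathcal Y$. In round $t$ play $z_t=(x_t,y_t)$, form estimates $\bar G_t^x,\bar G_t^y$ of $\nabla_xf_t(z_t),\nabla_yf_t(z_t)$, let $s_t\in\arg\min_{z\in\mathcal X\times\mathcal Y}\langle z,(\bar G_t^x,-\bar G_t^y)\rangle$ be given by a linear minimization oracle, and set $z_{t+1}=(1-\gamma)z_t+\gamma s_t$ with $\gamma=\sqrt{M_T/T}$. Let $$\mathfrak R_{DSPM}=\mathbf E\sum_{t=1}^T\big(f_t(x_t,y_t)-f_t(x_t^*,y_t^*)\big)^2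 .$$ Then there is a constant $C$ that depends only on $\kappa$ and the constants $\mu_X,\mu_Y,L_X,L_Y,L_{GX},L_{GY},L_{XY},L_{YX},D_{\mathcal X},D_{\mathcal Y},\delta_{\mathcal X},\delta_{\mathcal Y}$ (not on $T,\sigma,V_T,W_T$, the dimensions, the sets or the functions) such that the following hold. (a) Zeroth-order setting. Let $$\bar G_t^x=\frac1{m^X}\sum_{j=1}^{m^X}\frac{F_t(x_t+\nu_Xu_{t,j,x},y_t,\xi_{t,j,x})-F_t(x_t,y_t,\xi_{t,j,x})}{\nu_X}\,u_{t,j,x},$$ and let $\bar G_t^y$ be defined in the same way with $y_t+\nu_Yu_{t,j,y}$. Here the $u$'s are standard Gaussian vectors, the $\xi$'s have law $P$, all are independent, and $m^{X}=T(d_{X}+5)$, $m^{Y}=T(d_{Y}+5)$, $\nu_{X}=1/\sqrt{T(d_{X}+3)^3}$, $\nu_{Y}=1/\sqrt{T(d_{Y}+3)^3}$. Then $$\mathfrak R_{DSPM}\le C\sqrt{T M_T}\Big(1+\frac{\sigma^2}{M_T}\Big),$$ and the total number of calls to the zeroth-order oracle in $T$ rounds is at most $C(d_X+d_Y)T^2$.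 (b) First-order setting. Let $\bar G_t^{x}=\frac1{T}\sum_{j=1}^{T}\nabla_{x}F_t(x_t,y_t,\xi_{t,j})$ and $\bar G_t^{y}=\frac1{T}\sum_{j=1}^{T}\nabla_{y}F_t(x_t,y_t,\xi_{t,j})$, with independent $\xi_{t,j}$ of law $P$. Then the same bound $\mathfrak R_{DSPM}\le C\sqrt{T M_T}\,(1+\sigma^2/M_T)$ holds. -/

import Mathlib

open MeasureTheory ProbabilityTheory
open scoped InnerProductSpace

namespace OnlineSaddle

noncomputable section

/-- `d`-dimensional Euclidean space. -/
abbrev E (d : ℕ) : Type := EuclideanSpace ℝ (Fin d)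

/-- The numerical constants of the problem class. -/
structure Constants where
  (muX muY LX LY LGX LGY LXY LYX DX DY deltaX deltaY : ℝ)

/-- The signs these constants are understood to have. -/
structure Constants.Valid (c : Constants) : Prop where
  muX_pos : 0 < c.muX
  muY_pos : 0 < c.muY
  LX_nonneg : 0 ≤ c.LX
  LY_nonneg : 0 ≤ c.LY
  LGX_nonneg : 0 ≤ c.LGX
  LGY_nonneg : 0 ≤ c.LGY
  LXY_nonneg : 0 ≤ c.LXY
  LYX_nonneg : 0 ≤ c.LYX
  DX_nonneg : 0 ≤ c.DX
  DY_nonneg : 0 ≤ c.DY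
  deltaX_pos : 0 < c.deltaX
  deltaY_pos : 0 < c.deltaY

/-- `δ_μ = √(min(μ_X δ_X², μ_Y δ_Y²))`. -/
def Constants.deltaMu (c : Constants) : ℝ :=
  √(min (c.muX * c.deltaX ^ 2) (c.muY * c.deltaY ^ 2))

/-- `C₀ = 1 - (√2 / δ_μ) max {D_X L_XY / √μ_Y, D_Y L_YX / √μ_X}`. -/
def Constants.C0 (c : Constants) : ℝ :=
  1 - √2 / c.deltaMu * max (c.DX * c.LXY / √c.muY) (c.DY * c.LYX / √c.muX)

section Functions

variable {dX dY : ℕ} {Ξ : Type*} [MeasurableSpace Ξ]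

/-- Partial gradient `∇ₓ f(x, y)`. -/
def gradX (f : E dX → E dY → ℝ) (x : E dX) (y : E dY) : E dX :=
  gradient (fun x' => f x' y) x

/-- Partial gradient `∇_y f(x, y)`. -/
def gradY (f : E dX → E dY → ℝ) (x : E dX) (y : E dY) : E dY :=
  gradient (fun y' => f x y') y

/-- The random function with its noise frozen at `ξ`. -/
def atNoise (F : E dX → E dY → Ξ → ℝ) (ξ : Ξ) (x : E dX) (y : E dY) : ℝ := F x y ξ

/-- `f(x, y) = E_ξ F(x, y, ξ)`. -/
def mean (P : Measure Ξ) (F : E dX → E dY → Ξ → ℝ) (x : E dX) (y : E dY) : ℝ :=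
  ∫ ξ, F x y ξ ∂P

/-- `F(·, ·, ξ)` is continuously differentiable in each of its two variables, `μ_X`-strongly
convex in `x ∈ X` and `μ_Y`-strongly concave in `y ∈ Y`. -/
structure StronglyConvexConcave (c : Constants) (X : Set (E dX)) (Y : Set (E dY))
    (F : E dX → E dY → Ξ → ℝ) : Prop where
  contDiff_x : ∀ ξ y, ContDiff ℝ 1 (fun x => F x y ξ)
  contDiff_y : ∀ ξ x, ContDiff ℝ 1 (fun y => F x y ξ)
  convex : ∀ ξ, ∀ y ∈ Y, StrongConvexOn X c.muX (fun x => F x y ξ)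
  concave : ∀ ξ, ∀ x ∈ X, StrongConcaveOn Y c.muY (fun y => F x y ξ)

/-- Almost surely `F` is `L_X`-Lipschitz in `x` and `L_Y`-Lipschitz in `y` on `X × Y`.  (A strongly
convex function is not Lipschitz on the whole space.) -/
def LipschitzFunction (c : Constants) (P : Measure Ξ) (X : Set (E dX)) (Y : Set (E dY))
    (F : E dX → E dY → Ξ → ℝ) : Prop :=
  ∀ᵐ ξ ∂P,
    (∀ x₁ ∈ X, ∀ x₂ ∈ X, ∀ y ∈ Y, |F x₁ y ξ - F x₂ y ξ| ≤ c.LX * ‖x₁ - x₂‖) ∧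
    (∀ x ∈ X, ∀ y₁ ∈ Y, ∀ y₂ ∈ Y, |F x y₁ ξ - F x y₂ ξ| ≤ c.LY * ‖y₁ - y₂‖)

/-- Almost surely `∇ₓF` is `L_GX`-Lipschitz in `x` and `∇_yF` is `L_GY`-Lipschitz in `y`.  The
differentiated variable ranges over the whole space, since the zeroth-order method queries `F` at
Gaussian perturbations of points of `X` and of `Y`. -/
def LipschitzGradient (c : Constants) (P : Measure Ξ) (X : Set (E dX)) (Y : Set (E dY))
    (F : E dX → E dY → Ξ → ℝ) : Prop :=
  ∀ᵐ ξ ∂P,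
    (∀ x₁ x₂, ∀ y ∈ Y,
      ‖gradX (atNoise F ξ) x₁ y - gradX (atNoise F ξ) x₂ y‖ ≤ c.LGX * ‖x₁ - x₂‖) ∧
    (∀ x ∈ X, ∀ y₁ y₂,
      ‖gradY (atNoise F ξ) x y₁ - gradY (atNoise F ξ) x y₂‖ ≤ c.LGY * ‖y₁ - y₂‖)

/-- Almost surely `∇ₓF` is `L_XY`-Lipschitz in `y` and `∇_yF` is `L_YX`-Lipschitz in `x`. -/
def LipschitzPartialGradient (c : Constants) (P : Measure Ξ) (X : Set (E dX)) (Y : Set (E dY))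
    (F : E dX → E dY → Ξ → ℝ) : Prop :=
  ∀ᵐ ξ ∂P,
    (∀ x ∈ X, ∀ y₁ ∈ Y, ∀ y₂ ∈ Y,
      ‖gradX (atNoise F ξ) x y₁ - gradX (atNoise F ξ) x y₂‖ ≤ c.LXY * ‖y₁ - y₂‖) ∧
    (∀ x₁ ∈ X, ∀ x₂ ∈ X, ∀ y ∈ Y,
      ‖gradY (atNoise F ξ) x₁ y - gradY (atNoise F ξ) x₂ y‖ ≤ c.LYX * ‖x₁ - x₂‖)

/-- `F(x, y, ξ)` has a finite mean `f(x, y)`, the stochastic partial gradients are unbiased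
estimators of those of `f`, and their variance is at most `σ²`. -/
structure StochasticOracle (P : Measure Ξ) (σ : ℝ) (X : Set (E dX)) (Y : Set (E dY))
    (F : E dX → E dY → Ξ → ℝ) : Prop where
  integrable : ∀ x ∈ X, ∀ y ∈ Y, Integrable (fun ξ => F x y ξ) P
  integrable_gradX : ∀ x ∈ X, ∀ y ∈ Y, Integrable (fun ξ => gradX (atNoise F ξ) x y) P
  integrable_gradY : ∀ x ∈ X, ∀ y ∈ Y, Integrable (fun ξ => gradY (atNoise F ξ) x y) P
  unbiased_x : ∀ x ∈ X, ∀ y ∈ Y,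
    HasGradientAt (fun x' => mean P F x' y) (∫ ξ, gradX (atNoise F ξ) x y ∂P) x
  unbiased_y : ∀ x ∈ X, ∀ y ∈ Y,
    HasGradientAt (fun y' => mean P F x y') (∫ ξ, gradY (atNoise F ξ) x y ∂P) y
  variance_x : ∀ x ∈ X, ∀ y ∈ Y,
    Integrable (fun ξ => ‖gradX (atNoise F ξ) x y - gradX (mean P F) x y‖ ^ 2) P ∧
      ∫ ξ, ‖gradX (atNoise F ξ) x y - gradX (mean P F) x y‖ ^ 2 ∂P ≤ σ ^ 2
  variance_y : ∀ x ∈ X, ∀ y ∈ Y,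
    Integrable (fun ξ => ‖gradY (atNoise F ξ) x y - gradY (mean P F) x y‖ ^ 2) P ∧
      ∫ ξ, ‖gradY (atNoise F ξ) x y - gradY (mean P F) x y‖ ^ 2 ∂P ≤ σ ^ 2

/-- `(xs, ys)` is a saddle point of `f` on `X × Y` that is interior and has distance at least
`δ_X`, `δ_Y` from the two boundaries. -/
structure InteriorSaddlePoint (c : Constants) (X : Set (E dX)) (Y : Set (E dY))
    (f : E dX → E dY → ℝ) (xs : E dX) (ys : E dY) : Prop where
  saddle : IsSaddlePointOn X Y f xs ys
  mem_x : xs ∈ interior X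
  mem_y : ys ∈ interior Y
  border_x : c.deltaX ≤ Metric.infDist xs (frontier X)
  border_y : c.deltaY ≤ Metric.infDist ys (frontier Y)

/-- `sup_{(x, y) ∈ X × Y} |f(x, y) - g(x, y)|`. -/
def supDist (X : Set (E dX)) (Y : Set (E dY)) (f g : E dX → E dY → ℝ) : ℝ :=
  sSup ((fun z : E dX × E dY => |f z.1 z.2 - g z.1 z.2|) '' (X ×ˢ Y))

/-- The class `M_T`: the squared path variation of the saddle points of the rounds `1, …, T` is at
most `V`. -/
def PathVariationLE (T : ℕ) (V : ℝ) (xs : ℕ → E dX) (ys : ℕ → E dY) : Prop :=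
  ∑ t ∈ Finset.Ico 1 T, (‖xs (t + 1) - xs t‖ ^ 2 + ‖ys (t + 1) - ys t‖ ^ 2) ≤ V

/-- The class `D_T`: the variation of the functions of the rounds `1, …, T` is at most `W`. -/
def FunctionVariationLE (T : ℕ) (W : ℝ) (X : Set (E dX)) (Y : Set (E dY))
    (f : ℕ → E dX → E dY → ℝ) : Prop :=
  ∑ t ∈ Finset.Ico 1 T, supDist X Y (f t) (f (t + 1)) ≤ W

end Functions

section Algorithm

variable {dX dY : ℕ} {Ξ : Type*}

/-! Computations that use an oracle return their value together with the number of oracle calls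
they made; such pairs are added componentwise. -/

/-- One call of the zeroth-order oracle. -/
def query (F : E dX → E dY → Ξ → ℝ) (x : E dX) (y : E dY) (ξ : Ξ) : ℝ × ℕ := (F x y ξ, 1)

/-- `((F(x + ν u, y, ξ) - F(x, y, ξ)) / ν) u`. -/
def zoTermX (F : E dX → E dY → Ξ → ℝ) (ν : ℝ) (x : E dX) (y : E dY) (s : E dX × Ξ) :
    E dX × ℕ :=
  let a := query F (x + ν • s.1) y s.2
  let b := query F x y s.2
  (((a.1 - b.1) / ν) • s.1, a.2 + b.2)

/-- `((F(x, y + ν u, ξ) - F(x, y, ξ)) / ν) u`. -/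
def zoTermY (F : E dX → E dY → Ξ → ℝ) (ν : ℝ) (x : E dX) (y : E dY) (s : E dY × Ξ) :
    E dY × ℕ :=
  let a := query F x (y + ν • s.1) s.2
  let b := query F x y s.2
  (((a.1 - b.1) / ν) • s.1, a.2 + b.2)

/-- The zeroth-order mini-batch estimator `[Ḡˣ; Ḡʸ]` with batch sizes `mX`, `mY` and smoothing
parameters `νX`, `νY`.  The `j`-th sample is `((u_{j,x}, ξ_{j,x}), (u_{j,y}, ξ_{j,y}))`. -/
def zoGradest (F : E dX → E dY → Ξ → ℝ) (νX νY : ℝ) (mX mY : ℕ)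
    (S : ℕ → (E dX × Ξ) × (E dY × Ξ)) (z : E dX × E dY) : (E dX × E dY) × ℕ :=
  let gx := ∑ j ∈ Finset.range mX, zoTermX F νX z.1 z.2 (S j).1
  let gy := ∑ j ∈ Finset.range mY, zoTermY F νY z.1 z.2 (S j).2
  (((1 / (mX : ℝ)) • gx.1, (1 / (mY : ℝ)) • gy.1), gx.2 + gy.2)

/-- One call of the first-order oracle, which returns both stochastic partial gradients. -/
def gradQuery (F : E dX → E dY → Ξ → ℝ) (z : E dX × E dY) (ξ : Ξ) : (E dX × E dY) × ℕ :=
  ((gradX (atNoise F ξ) z.1 z.2, gradY (atNoise F ξ) z.1 z.2), 1)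

/-- The first-order mini-batch estimator with batch size `m`. -/
def foGradest (F : E dX → E dY → Ξ → ℝ) (m : ℕ) (S : ℕ → Ξ) (z : E dX × E dY) :
    (E dX × E dY) × ℕ :=
  let g := ∑ j ∈ Finset.range m, gradQuery F z (S j)
  ((1 / (m : ℝ)) • g.1, g.2)

/-- The step size `γ = √(M / T)`. -/
def stepSize (T : ℕ) (M : ℝ) : ℝ := √(M / (T : ℝ))

/-- The batch size `T (d + 5)`. -/
def batchSize (T d : ℕ) : ℕ := T * (d + 5)

/-- The smoothing parameter `1 / √(T (d + 3)³)`. -/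
def smoothing (T d : ℕ) : ℝ := 1 / √((T : ℝ) * ((d : ℝ) + 3) ^ 3)

/-- The gradient estimator of round `t` in the zeroth-order setting; `S t j` is the `j`-th sample
of round `t`. -/
def zoEst (T : ℕ) (F : ℕ → E dX → E dY → Ξ → ℝ) (S : ℕ → ℕ → (E dX × Ξ) × (E dY × Ξ)) (t : ℕ) :
    E dX × E dY → (E dX × E dY) × ℕ :=
  zoGradest (F t) (smoothing T dX) (smoothing T dY) (batchSize T dX) (batchSize T dY) (S t)

/-- The gradient estimator of round `t` in the first-order setting, with batch size `T`. -/
def foEst (T : ℕ) (F : ℕ → E dX → E dY → Ξ → ℝ) (S : ℕ → ℕ → Ξ) (t : ℕ) :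
    E dX × E dY → (E dX × E dY) × ℕ :=
  foGradest (F t) T (S t)

/-- A linear minimization oracle over `X × Y`: `lmo r ∈ argmin_{z ∈ X × Y} ⟨z, r⟩`, with a
measurable choice of the minimizer. -/
structure IsLMO (X : Set (E dX)) (Y : Set (E dY)) (lmo : E dX × E dY → E dX × E dY) : Prop where
  measurable : Measurable lmo
  mem : ∀ r, lmo r ∈ X ×ˢ Y
  le : ∀ r, ∀ z ∈ X ×ˢ Y,
    ⟪(lmo r).1, r.1⟫_ℝ + ⟪(lmo r).2, r.2⟫_ℝ ≤ ⟪z.1, r.1⟫_ℝ + ⟪z.2, r.2⟫_ℝ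

/-- The Frank-Wolfe method: the current point and the number of oracle calls made, after `n`
rounds.  In round `t` the gradient estimator `est t` is called at the current point, giving
`(gˣ, gʸ)`; then `r = (gˣ, -gʸ)`, `s = lmo_t r` and `z ← (1 - γ) z + γ s`. -/
def fwState (γ : ℝ) (lmo : ℕ → E dX × E dY → E dX × E dY)
    (est : ℕ → E dX × E dY → (E dX × E dY) × ℕ) (z₁ : E dX × E dY) :
    ℕ → (E dX × E dY) × ℕ
  | 0 => (z₁, 0)
  | n + 1 =>
    let z := fwState γ lmo est z₁ n
    let g := est (n + 1) z.1
    let s := lmo (n + 1) (g.1.1, -g.1.2)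
    ((1 - γ) • z.1 + γ • s, z.2 + g.2)

/-- The pair `(x_t, y_t)` played in round `t = 1, 2, …`. -/
def played (γ : ℝ) (lmo : ℕ → E dX × E dY → E dX × E dY)
    (est : ℕ → E dX × E dY → (E dX × E dY) × ℕ) (z₁ : E dX × E dY) (t : ℕ) : E dX × E dY :=
  (fwState γ lmo est z₁ (t - 1)).1

/-- `∑_{t=1}^T (f_t(x_t, y_t) - f_t(x_t^*, y_t^*))²` for a sequence `z t = (x_t, y_t)` of plays. -/
def meritLoss (f : ℕ → E dX → E dY → ℝ) (xs : ℕ → E dX) (ys : ℕ → E dY) (T : ℕ)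
    (z : ℕ → E dX × E dY) : ℝ :=
  ∑ t ∈ Finset.Icc 1 T, (f t (z t).1 (z t).2 - f t (xs t) (ys t)) ^ 2

/-- The random variables `S t j` (round `t`, sample `j`) are independent with common law `law`. -/
structure IsIID {Ω A : Type*} [MeasurableSpace Ω] [MeasurableSpace A] (Pr : Measure Ω)
    (law : Measure A) (S : ℕ → ℕ → Ω → A) : Prop where
  measurable : ∀ t j, Measurable (S t j)
  law_eq : ∀ t j, Pr.map (S t j) = law
  indep : iIndepFun (fun p : ℕ × ℕ => S p.1 p.2) Pr

/-- The law of a zeroth-order sample: `u_x ∼ N(0, I)`, `ξ_x ∼ P`, `u_y ∼ N(0, I)`, `ξ_y ∼ P`, all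
independent. -/
def zoLaw (dX dY : ℕ) {Ξ : Type*} [MeasurableSpace Ξ] (P : Measure Ξ) :
    Measure ((E dX × Ξ) × (E dY × Ξ)) :=
  ((stdGaussian (E dX)).prod P).prod ((stdGaussian (E dY)).prod P)

end Algorithm

/-- `√(T M) (1 + σ² / M)`. -/
def regretRate (T : ℕ) (M σ : ℝ) : ℝ := √((T : ℝ) * M) * (1 + σ ^ 2 / M)

end

end OnlineSaddle

open OnlineSaddle

/-! The quantity to follow is the duality gap `max_y f_t(x, ·) - min_x f_t(·, y)` at the iterates.
It dominates the distance of `f_t(x_t, y_t)` from the saddle value (`Regular.abs_sub_saddle_le`),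
and it is bounded by a constant `H`, so the squared loss of a round is at most `H` times its gap.

A Frank–Wolfe step shrinks the gap. Its first half depends on `x` only and its second on `y` only,
so they are treated separately, and symmetrically after replacing `f` by `-f`. Since the maximizer
over `y` is a Lipschitz function of `x`, the first half changes to first order by `γ⟨∇ₓf, s - x⟩`
plus a coupling error proportional to the distance from `y` to that maximizer. Because the saddle
point is the centre of a ball of radius `δ`, the linear minimizer gains an extra `δ‖∇ₓf‖`, and
strong convexity bounds `‖∇ₓf‖` below by the square root of the suboptimality. Quadratic growth
bounds the coupling error by the square root of the other half. The condition `0 ≤ C₀` says exactly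
that the coupling coefficients are at most `δ_μ`, whereas the gain is at least `√2 δ_μ`; a net
decrease `γ(√2 - 1)δ_μ √gap` remains (`Regular.dualityGap_step_le`). As the gap is at most `H`, this
is at least a constant times `γ · gap`.

Passing from `f_t` to `f_{t+1}` costs at most `2 sup |f_t - f_{t+1}|`, and an inexact gradient costs
`γ²` times a constant plus its squared error. Summing, and using `Tγ² = M`, bounds the sum of the
gaps by a constant times `(1 + M + ∑ squared errors) / γ` on every path (`meritLoss_le`).

It remains to see that each squared error has mean `O((1 + σ²)/T)`. An iterate depends on earlier
rounds only, hence is independent of the fresh samples, and it suffices to bound the error at a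
fixed point. For averaged gradients this is the variance of a mean. For Gaussian finite differences,
each term is `⟨∇F, u⟩u`, which is unbiased with second moment linear in the dimension, plus a
remainder of size at most `νL‖u‖³`; batch size and smoothing parameter cancel both dimension factors
(`lintegral_zerothOrder_le`). Finally `(M + σ²)/γ` is the claimed rate, and the lower bound `κ`
absorbs the additive constant. -/

namespace OnlineSaddle

/-! ### Strongly convex and smooth functions of one variable -/

section OneVariable

variable {H : Type*} [NormedAddCommGroup H] [InnerProductSpace ℝ H]

/-- First-order characterization of strong convexity. -/
theorem strongConvexOn_first_order [CompleteSpace H] {X : Set H} {m : ℝ} {φ : H → ℝ} {x x' g : H}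
    (h : StrongConvexOn X m φ) (hg : HasGradientAt φ g x) (hx : x ∈ X) (hx' : x' ∈ X) :
    φ x + ⟪g, x' - x⟫_ℝ + m / 2 * ‖x' - x‖ ^ 2 ≤ φ x' := by
  have hd : HasDerivAt (fun a : ℝ => φ (x + a • (x' - x))) ⟪g, x' - x⟫_ℝ 0 := by
    have h1 : HasDerivAt (fun a : ℝ => x + a • (x' - x)) ((1 : ℝ) • (x' - x)) 0 :=
      ((hasDerivAt_id (0 : ℝ)).smul_const (x' - x)).const_add x
    have h2 : HasFDerivAt φ ((InnerProductSpace.toDual ℝ H) g) (x + (0 : ℝ) • (x' - x)) := by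
      simpa using hg.hasFDerivAt
    have h3 := h2.comp_hasDerivAt (0 : ℝ) h1
    simp only [one_smul, InnerProductSpace.toDual_apply_apply] at h3
    exact h3
  have hlim := hd.tendsto_slope_zero_right
  -- The strong convexity inequality divided by `a` bounds the difference quotient by this
  -- expression; the claim is its limit as `a ↓ 0`.
  have hlim2 : Filter.Tendsto (fun a : ℝ => φ x' - φ x - (1 - a) * (m / 2 * ‖x' - x‖ ^ 2))
      (nhdsWithin 0 (Set.Ioi 0)) (nhds (φ x' - φ x - (1 - 0) * (m / 2 * ‖x' - x‖ ^ 2))) := by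
    apply Filter.Tendsto.mono_left _ nhdsWithin_le_nhds
    apply Continuous.tendsto
    fun_prop
  have := le_of_tendsto_of_tendsto hlim hlim2 (by
    filter_upwards [Ioo_mem_nhdsGT (zero_lt_one' ℝ)] with a ha
    have h3 := h.2 hx hx' (sub_nonneg.2 ha.2.le) ha.1.le (by ring : (1 - a) + a = 1)
    have h4 : (1 - a) • x + a • x' = x + a • (x' - x) := by module
    rw [h4, norm_sub_rev x x'] at h3
    simp only [zero_add, zero_smul, add_zero, smul_eq_mul] at h3 ⊢
    rw [inv_mul_le_iff₀ ha.1]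
    nlinarith)
  linarith

/-- In the first-order inequality the decrease at distance `r` is at most `‖g‖ r - m r² / 2`, whose
maximum over `r` is `‖g‖² / (2m)`. This turns suboptimality into a lower bound for the gradient. -/
theorem sqrt_le_norm_gradient [CompleteSpace H] {X : Set H} {m : ℝ} (hm : 0 < m) {φ : H → ℝ}
    {x x' g : H} (h : StrongConvexOn X m φ) (hg : HasGradientAt φ g x) (hx : x ∈ X)
    (hx' : x' ∈ X) : √(2 * m * (φ x - φ x')) ≤ ‖g‖ := by
  apply Real.sqrt_le_iff.2 ⟨norm_nonneg _, _⟩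
  have h1 := strongConvexOn_first_order h hg hx hx'
  have h2 := neg_le_of_abs_le (abs_real_inner_le_norm g (x' - x))
  have h3 : 2 * m * (φ x - φ x') ≤ 2 * m * (‖g‖ * ‖x' - x‖ - m / 2 * ‖x' - x‖ ^ 2) := by
    apply mul_le_mul_of_nonneg_left _ (by positivity)
    linarith
  nlinarith [sq_nonneg (‖g‖ - m * ‖x' - x‖)]

/-- Quadratic growth of a strongly concave function at its maximizer. -/
theorem strongConcaveOn_quadratic_growth {Y : Set H} {m : ℝ} {ψ : H → ℝ} {yh y : H}
    (h : StrongConcaveOn Y m ψ) (hmax : ∀ y' ∈ Y, ψ y' ≤ ψ yh) (hyh : yh ∈ Y) (hy : y ∈ Y) :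
    m / 2 * ‖yh - y‖ ^ 2 ≤ ψ yh - ψ y := by
  have hlim : Filter.Tendsto (fun a : ℝ => (1 - a) * (m / 2 * ‖yh - y‖ ^ 2))
      (nhdsWithin 0 (Set.Ioi 0)) (nhds ((1 - 0) * (m / 2 * ‖yh - y‖ ^ 2))) := by
    apply Filter.Tendsto.mono_left _ nhdsWithin_le_nhds
    apply Continuous.tendsto
    fun_prop
  have := le_of_tendsto hlim (b := ψ yh - ψ y) (by
    filter_upwards [Ioo_mem_nhdsGT (zero_lt_one' ℝ)] with a ha
    have h3 := h.2 hyh hy (sub_nonneg.2 ha.2.le) ha.1.le (by ring : (1 - a) + a = 1)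
    have h5 := hmax _ (h.1 hyh hy (sub_nonneg.2 ha.2.le) ha.1.le (by ring : (1 - a) + a = 1))
    simp only [smul_eq_mul] at h3
    have : a * ((1 - a) * (m / 2 * ‖yh - y‖ ^ 2)) ≤ a * (ψ yh - ψ y) := by nlinarith
    exact le_of_mul_le_mul_left this ha.1)
  linarith

/-- Two-point form of the mean value inequality. -/
theorem abs_sub_sub_inner_le [CompleteSpace H] {X : Set H} (hX : Convex ℝ X) {φ : H → ℝ}
    {g : H → H} (hg : ∀ z ∈ X, HasGradientAt φ (g z) z) {v : H} {K : ℝ} {x x' : H}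
    (hK : ∀ z ∈ segment ℝ x x', ‖g z - v‖ ≤ K) (hx : x ∈ X) (hx' : x' ∈ X) :
    |φ x' - φ x - ⟪v, x' - x⟫_ℝ| ≤ K * ‖x' - x‖ := by
  have := (convex_segment (𝕜 := ℝ) x x').norm_image_sub_le_of_norm_hasFDerivWithin_le'
    (f := φ) (f' := fun z => InnerProductSpace.toDual ℝ H (g z))
    (φ := InnerProductSpace.toDual ℝ H v) (C := K)
    (fun z hz => (hg z (hX.segment_subset hx hx' hz)).hasFDerivAt.hasFDerivWithinAt)
    (fun z hz => by
      rw [← map_sub, LinearIsometryEquiv.norm_map]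
      exact hK z hz) (left_mem_segment ℝ x x') (right_mem_segment ℝ x x')
  simpa using this

theorem norm_sub_le_of_mem_segment {x x' z : H} (hz : z ∈ segment ℝ x x') :
    ‖z - x‖ ≤ ‖x' - x‖ := by
  rw [segment_eq_image'] at hz
  obtain ⟨a, ha, rfl⟩ := hz
  simp only [add_sub_cancel_left, norm_smul, Real.norm_eq_abs, abs_of_nonneg ha.1]
  exact mul_le_of_le_one_left (norm_nonneg _) ha.2

/-- Descent lemma (with a non-optimal constant). -/
theorem abs_sub_sub_inner_le_sq [CompleteSpace H] {X : Set H} (hX : Convex ℝ X) {φ : H → ℝ}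
    {g : H → H} (hg : ∀ z ∈ X, HasGradientAt φ (g z) z) {L : ℝ} (hL : 0 ≤ L) {x x' : H}
    (hlip : ∀ z ∈ X, ‖g z - g x‖ ≤ L * ‖z - x‖) (hx : x ∈ X) (hx' : x' ∈ X) :
    |φ x' - φ x - ⟪g x, x' - x⟫_ℝ| ≤ L * ‖x' - x‖ ^ 2 := by
  have := abs_sub_sub_inner_le hX hg (v := g x) (K := L * ‖x' - x‖) (fun z hz =>
    (hlip z (hX.segment_subset hx hx' hz)).trans
      (mul_le_mul_of_nonneg_left (norm_sub_le_of_mem_segment hz) hL)) hx hx'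
  rwa [mul_assoc, ← sq] at this

/-- Progress guaranteed by an inexact linear minimization over a set containing a ball. -/
theorem inner_linearMin_le {X : Set H} {xs x s g G : H} {δ D : ℝ} (hδ : 0 ≤ δ)
    (hball : Metric.closedBall xs δ ⊆ X) (hD : ∀ u ∈ X, ∀ v ∈ X, ‖u - v‖ ≤ D)
    (hs : s ∈ X) (hmin : ∀ v ∈ X, ⟪s, G⟫_ℝ ≤ ⟪v, G⟫_ℝ) :
    ⟪g, s - x⟫_ℝ ≤ ⟪g, xs - x⟫_ℝ - δ * ‖g‖ + D * ‖G - g‖ := by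
  obtain ⟨v, hv, hvg⟩ : ∃ v ∈ X, ⟪g, v⟫_ℝ = ⟪g, xs⟫_ℝ - δ * ‖g‖ := by
    by_cases hg : ‖g‖ = 0
    · refine ⟨xs, hball (Metric.mem_closedBall_self hδ), by simp [hg]⟩
    -- The competitor is the point of the ball farthest in the direction opposite to the true
    -- gradient `g`; optimality of `s` is only known for `G`, and the exchange costs `D * ‖G - g‖`.
    · refine ⟨xs - (δ / ‖g‖) • g, hball ?_, ?_⟩
      · rw [Metric.mem_closedBall, dist_eq_norm, sub_sub_cancel_left, norm_neg, norm_smul,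
          Real.norm_eq_abs, abs_of_nonneg (by positivity), div_mul_cancel₀ _ hg]
      · rw [inner_sub_right, inner_smul_right, real_inner_self_eq_norm_sq]
        field_simp
  have h1 := hmin v hv
  have h2 : ⟪g - G, s - v⟫_ℝ ≤ ‖G - g‖ * D :=
    (real_inner_le_norm _ _).trans (by
      rw [norm_sub_rev]
      exact mul_le_mul_of_nonneg_left (hD s hs v hv) (norm_nonneg _))
  simp only [inner_sub_left, inner_sub_right] at h2 ⊢
  rw [real_inner_comm, real_inner_comm G v] at h1
  nlinarith

end OneVariable

/-! ### One block of variables: the maximum over `y` along a step in `x` -/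

section Saddle

variable {H₁ H₂ : Type*} [NormedAddCommGroup H₁] [InnerProductSpace ℝ H₁] [CompleteSpace H₁]
  [NormedAddCommGroup H₂] [InnerProductSpace ℝ H₂]

/-- A strongly convex-concave function `f` on `X × Y` with partial gradient `g` in the first
variable, seen from the first variable. -/
structure HalfRegular (X : Set H₁) (Y : Set H₂) (f : H₁ → H₂ → ℝ) (g : H₁ → H₂ → H₁)
    (L Lc m₁ m₂ D : ℝ) : Prop where
  compact : IsCompact X
  L_nonneg : 0 ≤ L
  Lc_nonneg : 0 ≤ Lc
  D_nonneg : 0 ≤ D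
  diam : ∀ u ∈ X, ∀ v ∈ X, ‖u - v‖ ≤ D
  grad : ∀ x ∈ X, ∀ y ∈ Y, HasGradientAt (fun x' => f x' y) (g x y) x
  lip : ∀ x₁ ∈ X, ∀ x₂ ∈ X, ∀ y ∈ Y, ‖g x₁ y - g x₂ y‖ ≤ L * ‖x₁ - x₂‖
  cross : ∀ x ∈ X, ∀ y₁ ∈ Y, ∀ y₂ ∈ Y, ‖g x y₁ - g x y₂‖ ≤ Lc * ‖y₁ - y₂‖
  convex : ∀ y ∈ Y, StrongConvexOn X m₁ (fun x => f x y)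
  concave : ∀ x ∈ X, StrongConcaveOn Y m₂ (fun y => f x y)

variable {X : Set H₁} {Y : Set H₂} {f : H₁ → H₂ → ℝ} {g : H₁ → H₂ → H₁} {L Lc m₁ m₂ D : ℝ}

/-- The maximizer of `f(x, ·)` is a Lipschitz function of `x`. -/
theorem HalfRegular.norm_argmax_sub_le (h : HalfRegular X Y f g L Lc m₁ m₂ D) (hm : 0 < m₂)
    (hX : Convex ℝ X) {x x' : H₁} (hx : x ∈ X) (hx' : x' ∈ X) {yh yh' : H₂} (hyh : yh ∈ Y) (hyh' : yh' ∈ Y)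
    (hmax : ∀ y ∈ Y, f x y ≤ f x yh) (hmax' : ∀ y ∈ Y, f x' y ≤ f x' yh') :
    ‖yh - yh'‖ ≤ Lc / m₂ * ‖x' - x‖ := by
  have h1 := strongConcaveOn_quadratic_growth (h.concave x hx) hmax hyh hyh'
  have h2 := strongConcaveOn_quadratic_growth (h.concave x' hx') hmax' hyh' hyh
  -- The two quadratic growth inequalities add up to `m₂ ‖yh - yh'‖²` on the left and to the
  -- increment of this difference between `x` and `x'` on the right. Its gradient is at most `Lc *
  -- ‖yh - yh'‖`, so one factor `‖yh - yh'‖` cancels.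
  have h3 := abs_sub_sub_inner_le hX (φ := fun x => f x yh - f x yh')
    (g := fun x => g x yh - g x yh') (v := 0) (K := Lc * ‖yh - yh'‖) (x := x) (x' := x')
    (fun z hz => by
      have := (h.grad z hz yh hyh).hasFDerivAt.sub (h.grad z hz yh' hyh').hasFDerivAt
      rw [← map_sub] at this
      exact this)
    (fun z hz => by
      rw [sub_zero]
      exact h.cross z (hX.segment_subset hx hx' hz) yh hyh yh' hyh') hx hx'
  have h4 := neg_le_of_abs_le h3
  rw [norm_sub_rev yh' yh] at h2
  simp only [inner_zero_left, sub_zero] at h4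
  rcases (norm_nonneg (yh - yh')).eq_or_lt with h0 | h0
  · rw [← h0]
    have := h.Lc_nonneg
    positivity
  · have h5 : ‖yh - yh'‖ * (m₂ * ‖yh - yh'‖) ≤ ‖yh - yh'‖ * (Lc * ‖x' - x‖) := by nlinarith
    have := le_of_mul_le_mul_left h5 h0
    rw [div_mul_eq_mul_div, le_div_iff₀ hm]
    linarith

/-- Change of the maximum over `y` along one conditional-gradient step in `x`. -/
theorem HalfRegular.max_step_le (h : HalfRegular X Y f g L Lc m₁ m₂ D) (hm : 0 < m₂)
    (hX : Convex ℝ X) {γ : ℝ} (hγ : 0 ≤ γ) (hγ1 : γ ≤ 1) {x s : H₁} {y : H₂} (hx : x ∈ X)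
    (hs : s ∈ X) (hy : y ∈ Y) {yh yh' : H₂} (hyh : yh ∈ Y) (hyh' : yh' ∈ Y)
    (hmax : ∀ y ∈ Y, f x y ≤ f x yh)
    (hmax' : ∀ y ∈ Y, f (x + γ • (s - x)) y ≤ f (x + γ • (s - x)) yh') :
    f (x + γ • (s - x)) yh' - f x yh ≤
      γ * (⟪g x y, s - x⟫_ℝ + D * Lc * ‖yh - y‖) + γ ^ 2 * ((L + Lc ^ 2 / m₂) * D ^ 2) := by
  have hx' : x + γ • (s - x) ∈ X := hX.add_smul_sub_mem hx hs ⟨hγ, hγ1⟩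
  have hsx : ‖s - x‖ ≤ D := h.diam s hs x hx
  have hn : ‖x + γ • (s - x) - x‖ = γ * ‖s - x‖ := by
    rw [add_sub_cancel_left, norm_smul, Real.norm_eq_abs, abs_of_nonneg hγ]
  -- The descent lemma is applied with the second variable frozen at the new maximizer `yh'`. Since
  -- `f x yh' ≤ f x yh`, this is enough to bound the change of the maximum.
  have h1 := le_of_abs_le (abs_sub_sub_inner_le_sq hX (fun z hz => h.grad z hz yh' hyh')
    h.L_nonneg (x := x) (fun z hz => h.lip z hz x hx yh' hyh') hx hx')
  have h2 := h.norm_argmax_sub_le hm hX hx hx' hyh hyh' hmax hmax'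
  rw [hn] at h1 h2
  rw [add_sub_cancel_left, inner_smul_right] at h1
  have h3 := hmax yh' hyh'
  have h4 : ⟪g x yh' - g x y, s - x⟫_ℝ ≤ Lc * ‖yh' - y‖ * D :=
    (real_inner_le_norm _ _).trans (mul_le_mul (h.cross x hx yh' hyh' y hy) hsx (norm_nonneg _)
      (mul_nonneg h.Lc_nonneg (norm_nonneg _)))
  -- The maximizer moves by `O(γ)`, so replacing `yh'` by `yh` here adds only a term of order `γ²`
  -- to the final bound.
  have h5 : ‖yh' - y‖ ≤ ‖yh - y‖ + Lc / m₂ * (γ * D) := by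
    have := norm_sub_le_norm_sub_add_norm_sub yh' yh y
    rw [norm_sub_rev yh' yh] at this
    have h6 : Lc / m₂ * (γ * ‖s - x‖) ≤ Lc / m₂ * (γ * D) := by
      have := h.Lc_nonneg
      gcongr
    linarith
  have h6 : Lc * ‖yh' - y‖ * D ≤ Lc * (‖yh - y‖ + Lc / m₂ * (γ * D)) * D :=
    mul_le_mul_of_nonneg_right (mul_le_mul_of_nonneg_left h5 h.Lc_nonneg) h.D_nonneg
  have h7 : L * (γ * ‖s - x‖) ^ 2 ≤ L * (γ * D) ^ 2 := by
    have := h.L_nonneg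
    gcongr
  rw [inner_sub_left] at h4
  have h8 : γ * ⟪g x yh', s - x⟫_ℝ ≤
      γ * (⟪g x y, s - x⟫_ℝ + Lc * (‖yh - y‖ + Lc / m₂ * (γ * D)) * D) :=
    mul_le_mul_of_nonneg_left (by linarith) hγ
  calc _ ≤ γ * (⟪g x y, s - x⟫_ℝ + Lc * (‖yh - y‖ + Lc / m₂ * (γ * D)) * D) + L * (γ * D) ^ 2 := by
        linarith
    _ = _ := by ring

/-- `HalfRegular.max_step_le` for an inexact linear minimization step. -/
theorem HalfRegular.max_frankWolfe_step_le (h : HalfRegular X Y f g L Lc m₁ m₂ D) (hm₁ : 0 < m₁)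
    (hm : 0 < m₂) (hX : Convex ℝ X) {γ : ℝ} (hγ : 0 ≤ γ) (hγ1 : γ ≤ 1) {x s : H₁} {y : H₂}
    (hx : x ∈ X) (hs : s ∈ X) (hy : y ∈ Y) {yh yh' : H₂} (hyh : yh ∈ Y) (hyh' : yh' ∈ Y)
    (hmax : ∀ y ∈ Y, f x y ≤ f x yh)
    (hmax' : ∀ y ∈ Y, f (x + γ • (s - x)) y ≤ f (x + γ • (s - x)) yh')
    {xh : H₁} (hxh : xh ∈ X) {xs G : H₁} {δ : ℝ} (hδ : 0 ≤ δ)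
    (hball : Metric.closedBall xs δ ⊆ X) (hmin : ∀ v ∈ X, ⟪s, G⟫_ℝ ≤ ⟪v, G⟫_ℝ) :
    f (x + γ • (s - x)) yh' - f x yh ≤
      γ * (f xs y - f x y - √2 * (δ * √m₁) * √(f x y - f xh y)
        + √2 * (D * Lc / √m₂) * √(f x yh - f x y) + D * ‖G - g x y‖)
      + γ ^ 2 * ((L + Lc ^ 2 / m₂) * D ^ 2) := by
  have hxs : xs ∈ X := hball (Metric.mem_closedBall_self hδ)
  have h1 := h.max_step_le hm hX hγ hγ1 hx hs hy hyh hyh' hmax hmax'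
  have h2 := inner_linearMin_le (g := g x y) (x := x) hδ hball h.diam hs hmin
  have h3 := sqrt_le_norm_gradient hm₁ (h.convex y hy) (h.grad x hx y hy) hx hxh
  have h4 := strongConvexOn_first_order (h.convex y hy) (h.grad x hx y hy) hx hxs
  have h5 := strongConcaveOn_quadratic_growth (h.concave x hx) hmax hyh hy
  have h6 : ‖yh - y‖ ≤ √2 / √m₂ * √(f x yh - f x y) := by
    rw [← Real.sqrt_div (by norm_num), ← Real.sqrt_mul (by positivity)]
    apply Real.le_sqrt_of_sq_le
    rw [div_mul_eq_mul_div, le_div_iff₀ hm]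
    linarith
  have h7 : √2 * (δ * √m₁) * √(f x y - f xh y) ≤ δ * ‖g x y‖ := by
    rw [mul_assoc 2, Real.sqrt_mul (by norm_num), Real.sqrt_mul hm₁.le] at h3
    calc _ = δ * (√2 * (√m₁ * √(f x y - f xh y))) := by ring
      _ ≤ _ := mul_le_mul_of_nonneg_left h3 hδ
  have h8 : D * Lc * ‖yh - y‖ ≤ √2 * (D * Lc / √m₂) * √(f x yh - f x y) := by
    calc _ ≤ D * Lc * (√2 / √m₂ * √(f x yh - f x y)) :=
          mul_le_mul_of_nonneg_left h6 (mul_nonneg h.D_nonneg h.Lc_nonneg)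
      _ = _ := by ring
  have h9 : 0 ≤ m₁ / 2 * ‖xs - x‖ ^ 2 := by positivity
  refine h1.trans (add_le_add (mul_le_mul_of_nonneg_left ?_ hγ) le_rfl)
  linarith

/-- The duality gap `max_{y' ∈ Y} f(x, y') - min_{x' ∈ X} f(x', y)`. -/
noncomputable def dualityGap {α β : Type*} (X : Set α) (Y : Set β) (f : α → β → ℝ) (x : α)
    (y : β) : ℝ :=
  sSup ((fun y' => f x y') '' Y) + sSup ((fun x' => -f x' y) '' X)

theorem dualityGap_eq {α β : Type*} {X : Set α} {Y : Set β} {f : α → β → ℝ} {x xh : α} {y yh : β}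
    (hyh : yh ∈ Y) (hxh : xh ∈ X) (hmax : ∀ y' ∈ Y, f x y' ≤ f x yh)
    (hmin : ∀ x' ∈ X, f xh y ≤ f x' y) : dualityGap X Y f x y = f x yh - f xh y := by
  have h1 : IsGreatest ((fun y' => f x y') '' Y) (f x yh) :=
    ⟨⟨yh, hyh, rfl⟩, by rintro _ ⟨y', hy', rfl⟩; exact hmax y' hy'⟩
  have h2 : IsGreatest ((fun x' => -f x' y) '' X) (-f xh y) :=
    ⟨⟨xh, hxh, rfl⟩, by rintro _ ⟨x', hx', rfl⟩; exact neg_le_neg (hmin x' hx')⟩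
  rw [dualityGap, h1.csSup_eq, h2.csSup_eq, sub_eq_add_neg]

/-- Differentiability gives continuity on the compact set `X`. Applied to `-f` with the variables
exchanged, it also supplies the maximizers over `Y`. -/
theorem HalfRegular.exists_argmin (h : HalfRegular X Y f g L Lc m₁ m₂ D)
    (hX : X.Nonempty) {y : H₂} (hy : y ∈ Y) : ∃ xh ∈ X, ∀ x ∈ X, f xh y ≤ f x y :=
  h.compact.exists_isMinOn hX fun x hx =>
    (h.grad x hx y hy).continuousAt.continuousWithinAt

end Saddle

/-! ### The duality gap: comparison, drift, contraction and summation -/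

section Gap

variable {H₁ H₂ : Type*} [NormedAddCommGroup H₁] [InnerProductSpace ℝ H₁] [CompleteSpace H₁]
  [NormedAddCommGroup H₂] [InnerProductSpace ℝ H₂] [CompleteSpace H₂]

/-- A strongly convex-concave function on `X × Y` with partial gradients `gx`, `gy`. -/
structure Regular (X : Set H₁) (Y : Set H₂) (f : H₁ → H₂ → ℝ) (gx : H₁ → H₂ → H₁)
    (gy : H₁ → H₂ → H₂) (L₁ L₂ L₁₂ L₂₁ m₁ m₂ D₁ D₂ : ℝ) : Prop where
  left : HalfRegular X Y f gx L₁ L₁₂ m₁ m₂ D₁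
  right : HalfRegular Y X (fun y x => -f x y) (fun y x => -gy x y) L₂ L₂₁ m₂ m₁ D₂

variable {X : Set H₁} {Y : Set H₂} {f f' : H₁ → H₂ → ℝ} {gx gx' : H₁ → H₂ → H₁}
  {gy gy' : H₁ → H₂ → H₂} {L₁ L₂ L₁₂ L₂₁ m₁ m₂ D₁ D₂ : ℝ}

theorem Regular.exists_dualityGap_eq (h : Regular X Y f gx gy L₁ L₂ L₁₂ L₂₁ m₁ m₂ D₁ D₂) {x : H₁}
    {y : H₂} (hx : x ∈ X) (hy : y ∈ Y) : ∃ xh ∈ X, ∃ yh ∈ Y, (∀ y' ∈ Y, f x y' ≤ f x yh) ∧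
      (∀ x' ∈ X, f xh y ≤ f x' y) ∧ dualityGap X Y f x y = f x yh - f xh y := by
  obtain ⟨xh, hxh, hmin⟩ := h.left.exists_argmin ⟨x, hx⟩ hy
  obtain ⟨yh, hyh, hmax⟩ := h.right.exists_argmin ⟨y, hy⟩ hx
  have hmax' : ∀ y' ∈ Y, f x y' ≤ f x yh := fun y' hy' => neg_le_neg_iff.1 (hmax y' hy')
  exact ⟨xh, hxh, yh, hyh, hmax', hmin, dualityGap_eq hyh hxh hmax' hmin⟩

theorem Regular.dualityGap_nonneg (h : Regular X Y f gx gy L₁ L₂ L₁₂ L₂₁ m₁ m₂ D₁ D₂) {x : H₁}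
    {y : H₂} (hx : x ∈ X) (hy : y ∈ Y) : 0 ≤ dualityGap X Y f x y := by
  obtain ⟨xh, hxh, yh, hyh, hmax, hmin, he⟩ := h.exists_dualityGap_eq hx hy
  linarith [hmax y hy, hmin x hx]

theorem Regular.dualityGap_le (h : Regular X Y f gx gy L₁ L₂ L₁₂ L₂₁ m₁ m₂ D₁ D₂) {x : H₁}
    {y : H₂} (hx : x ∈ X) (hy : y ∈ Y) {B₁ B₂ : ℝ} (hB₁ : 0 ≤ B₁) (hB₂ : 0 ≤ B₂)
    (h₁ : ∀ x₁ ∈ X, ∀ x₂ ∈ X, ∀ y ∈ Y, |f x₁ y - f x₂ y| ≤ B₁ * ‖x₁ - x₂‖)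
    (h₂ : ∀ x ∈ X, ∀ y₁ ∈ Y, ∀ y₂ ∈ Y, |f x y₁ - f x y₂| ≤ B₂ * ‖y₁ - y₂‖) :
    dualityGap X Y f x y ≤ B₁ * D₁ + B₂ * D₂ := by
  obtain ⟨xh, hxh, yh, hyh, hmax, hmin, he⟩ := h.exists_dualityGap_eq hx hy
  have e1 := le_of_abs_le (h₁ x hx xh hxh y hy)
  have e2 := le_of_abs_le (h₂ x hx yh hyh y hy)
  have e3 := mul_le_mul_of_nonneg_left (h.left.diam x hx xh hxh) hB₁
  have e4 := mul_le_mul_of_nonneg_left (h.right.diam yh hyh y hy) hB₂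
  linarith

/-- Both `f x y` and the saddle value lie between the minimum over `x'` of `f x' y` and the maximum
over `y'` of `f x y'`. -/
theorem Regular.abs_sub_saddle_le (h : Regular X Y f gx gy L₁ L₂ L₁₂ L₂₁ m₁ m₂ D₁ D₂) {x xs : H₁}
    {y ys : H₂} (hx : x ∈ X) (hy : y ∈ Y) (hxs : xs ∈ X) (hys : ys ∈ Y)
    (hsad : IsSaddlePointOn X Y f xs ys) : |f x y - f xs ys| ≤ dualityGap X Y f x y := by
  obtain ⟨xh, hxh, yh, hyh, hmax, hmin, he⟩ := h.exists_dualityGap_eq hx hy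
  have e1 := hsad x hx ys hys
  have e2 := hsad xs hxs y hy
  rw [abs_le]
  constructor <;> linarith [hmax ys hys, hmin xs hxs, hmax y hy, hmin x hx]

/-- Each of the two extremal values moves by at most `w`, which is the origin of the factor in `2
W_T`. -/
theorem Regular.dualityGap_le_add (h : Regular X Y f gx gy L₁ L₂ L₁₂ L₂₁ m₁ m₂ D₁ D₂)
    (h' : Regular X Y f' gx' gy' L₁ L₂ L₁₂ L₂₁ m₁ m₂ D₁ D₂) {x : H₁} {y : H₂} (hx : x ∈ X)
    (hy : y ∈ Y) {w : ℝ} (hw : ∀ x ∈ X, ∀ y ∈ Y, |f x y - f' x y| ≤ w) :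
    dualityGap X Y f' x y ≤ dualityGap X Y f x y + 2 * w := by
  obtain ⟨xh, hxh, yh, hyh, hmax, hmin, he⟩ := h.exists_dualityGap_eq hx hy
  obtain ⟨xh', hxh', yh', hyh', hmax', hmin', he'⟩ := h'.exists_dualityGap_eq hx hy
  have e1 := abs_le.1 (hw x hx yh' hyh')
  have e2 := abs_le.1 (hw xh' hxh' y hy)
  linarith [hmax yh' hyh', hmin xh' hxh']

/-- One inexact conditional-gradient step contracts the duality gap. -/
theorem Regular.dualityGap_step_le (h : Regular X Y f gx gy L₁ L₂ L₁₂ L₂₁ m₁ m₂ D₁ D₂)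
    (hX : Convex ℝ X) (hY : Convex ℝ Y) (hm₁ : 0 < m₁) (hm₂ : 0 < m₂) {γ : ℝ} (hγ : 0 ≤ γ)
    (hγ1 : γ ≤ 1) {x s xs G₁ : H₁} {y r ys G₂ : H₂} (hx : x ∈ X) (hs : s ∈ X) (hy : y ∈ Y)
    (hr : r ∈ Y) {δ₁ δ₂ q : ℝ} (hδ₁ : 0 ≤ δ₁) (hδ₂ : 0 ≤ δ₂)
    (hball₁ : Metric.closedBall xs δ₁ ⊆ X) (hball₂ : Metric.closedBall ys δ₂ ⊆ Y)
    (hsad : IsSaddlePointOn X Y f xs ys)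
    (hmin₁ : ∀ v ∈ X, ⟪s, G₁⟫_ℝ ≤ ⟪v, G₁⟫_ℝ) (hmin₂ : ∀ v ∈ Y, ⟪r, -G₂⟫_ℝ ≤ ⟪v, -G₂⟫_ℝ)
    (hq : 0 ≤ q) (hc₁ : √2 * (D₁ * L₁₂ / √m₂) ≤ q) (hc₂ : √2 * (D₂ * L₂₁ / √m₁) ≤ q)
    (hd₁ : q ≤ δ₁ * √m₁) (hd₂ : q ≤ δ₂ * √m₂) :
    dualityGap X Y f (x + γ • (s - x)) (y + γ • (r - y)) ≤ dualityGap X Y f x y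
      - γ * ((√2 - 1) * q * √(dualityGap X Y f x y))
      + γ * (D₁ * ‖G₁ - gx x y‖ + D₂ * ‖G₂ - gy x y‖)
      + γ ^ 2 * ((L₁ + L₁₂ ^ 2 / m₂) * D₁ ^ 2 + (L₂ + L₂₁ ^ 2 / m₁) * D₂ ^ 2) := by
  have hx' : x + γ • (s - x) ∈ X := hX.add_smul_sub_mem hx hs ⟨hγ, hγ1⟩
  have hy' : y + γ • (r - y) ∈ Y := hY.add_smul_sub_mem hy hr ⟨hγ, hγ1⟩
  have hxs : xs ∈ X := hball₁ (Metric.mem_closedBall_self hδ₁)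
  have hys : ys ∈ Y := hball₂ (Metric.mem_closedBall_self hδ₂)
  obtain ⟨xh, hxh, yh, hyh, hmax, hmin, he⟩ := h.exists_dualityGap_eq hx hy
  obtain ⟨xh', hxh', yh', hyh', hmax', hmin', he'⟩ := h.exists_dualityGap_eq hx' hy'
  have e1 := h.left.max_frankWolfe_step_le hm₁ hm₂ hX hγ hγ1 hx hs hy hyh hyh' hmax hmax' hxh hδ₁
    hball₁ hmin₁
  have e2 := h.right.max_frankWolfe_step_le hm₂ hm₁ hY hγ hγ1 hy hr hx hxh hxh'
    (fun v hv => neg_le_neg (hmin v hv)) (fun v hv => neg_le_neg (hmin' v hv)) hyh hδ₂ hball₂ hmin₂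
  have en : ‖-G₂ - -gy x y‖ = ‖G₂ - gy x y‖ := by rw [← neg_sub', norm_neg]
  have ea : -f x y - -f x yh = f x yh - f x y := by ring
  have eb : -f xh y - -f x y = f x y - f xh y := by ring
  rw [en, ea, eb] at e2
  -- The saddle inequality `f xs y ≤ f x ys` makes the linear terms `f xs y - f x y` and `f x y - f
  -- x ys` of the two halves sum to something nonpositive.
  have hsd := hsad x hx y hy
  rw [he', he]
  have hsum : √(f x yh - f xh y) ≤ √(f x yh - f x y) + √(f x y - f xh y) := by
    have e3 := Real.mul_self_sqrt (sub_nonneg.2 (hmax y hy))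
    have e4 := Real.mul_self_sqrt (sub_nonneg.2 (hmin x hx))
    refine Real.sqrt_le_iff.2 ⟨by positivity, ?_⟩
    nlinarith [mul_nonneg (Real.sqrt_nonneg (f x yh - f x y)) (Real.sqrt_nonneg (f x y - f xh y))]
  set A := √(f x yh - f x y)
  set B := √(f x y - f xh y)
  have hA : 0 ≤ A := Real.sqrt_nonneg _
  have hB : 0 ≤ B := Real.sqrt_nonneg _
  have h2 : (0 : ℝ) ≤ √2 := Real.sqrt_nonneg _
  have h21 : 0 ≤ √2 - 1 := sub_nonneg.2 (Real.one_le_sqrt.2 (by norm_num))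
  have k1 := mul_le_mul_of_nonneg_right hc₁ hA
  have k2 := mul_le_mul_of_nonneg_right hc₂ hB
  have k3 := mul_le_mul_of_nonneg_right (mul_le_mul_of_nonneg_left hd₁ h2) hB
  have k4 := mul_le_mul_of_nonneg_right (mul_le_mul_of_nonneg_left hd₂ h2) hA
  have k5 := mul_le_mul_of_nonneg_left hsum (mul_nonneg h21 hq)
  -- The gain in each half carries the root of its own suboptimality and the coupling error the root
  -- of the other one. After summation `A` and `B` each have coefficient at most `q - √2 q`, and `A
  -- + B` dominates the root of the gap.
  have key : (f xs y - f x y - √2 * (δ₁ * √m₁) * B + √2 * (D₁ * L₁₂ / √m₂) * A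
      + D₁ * ‖G₁ - gx x y‖) + (-f x ys - -f x y - √2 * (δ₂ * √m₂) * A
      + √2 * (D₂ * L₂₁ / √m₁) * B + D₂ * ‖G₂ - gy x y‖)
      ≤ -((√2 - 1) * q * √(f x yh - f xh y)) + (D₁ * ‖G₁ - gx x y‖ + D₂ * ‖G₂ - gy x y‖) := by
    linarith
  have := mul_le_mul_of_nonneg_left key hγ
  linarith

/-- Below a known ceiling `H`, a decrease proportional to `√h` is at least a linear one, and linear
decreases can be summed. -/
theorem mul_div_sqrt_le {a h H : ℝ} (ha : 0 ≤ a) (hh : 0 ≤ h) (hH : 0 < H) (hhH : h ≤ H) :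
    a / √H * h ≤ a * √h := by
  have : h / √H ≤ √h := by
    rw [div_le_iff₀ (Real.sqrt_pos.2 hH)]
    calc h = √h * √h := (Real.mul_self_sqrt hh).symm
      _ ≤ _ := mul_le_mul_of_nonneg_left (Real.sqrt_le_sqrt hhH) (Real.sqrt_nonneg _)
  calc _ = a * (h / √H) := by ring
    _ ≤ _ := mul_le_mul_of_nonneg_left this ha

/-- Summation of a contraction with drift. -/
theorem sum_le_of_contraction {T : ℕ} (hT : 1 ≤ T) {h k w e : ℕ → ℝ} {a K : ℝ}
    (hstep : ∀ t ∈ Finset.Icc 1 T, k t ≤ h t - a * h t + e t + K)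
    (hdrift : ∀ t ∈ Finset.Ico 1 T, h (t + 1) ≤ k t + w t) (hk : 0 ≤ k T) :
    a * ∑ t ∈ Finset.Icc 1 T, h t ≤
      h 1 + ∑ t ∈ Finset.Ico 1 T, w t + ∑ t ∈ Finset.Icc 1 T, e t + T * K := by
  -- The term `k n`, the gap of the `n`-th function after its step, is kept on the left so that the
  -- sum telescopes; it is discarded only at `n = T`.
  suffices ∀ n, 1 ≤ n → n ≤ T → k n + a * ∑ t ∈ Finset.Icc 1 n, h t ≤
      h 1 + ∑ t ∈ Finset.Ico 1 n, w t + ∑ t ∈ Finset.Icc 1 n, e t + n * K by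
    linarith [this T hT le_rfl]
  intro n hn
  induction n, hn using Nat.le_induction with
  | base =>
    intro h1
    have := hstep 1 (by simpa using hT)
    simp
    linarith
  | succ n hn ih =>
    intro h1
    have h2 := ih (by omega)
    have h3 := hstep (n + 1) (by simp; omega)
    have h4 := hdrift n (by simp; omega)
    rw [Finset.sum_Icc_succ_top (by omega), Finset.sum_Icc_succ_top (by omega),
      Finset.sum_Ico_succ_top (by omega)]
    push_cast
    linarith

end Gap

/-! ### Regularity passes from the random function to its mean -/

section Mean

variable {H₁ H₂ : Type*} [NormedAddCommGroup H₁] [InnerProductSpace ℝ H₁] [CompleteSpace H₁]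
  [NormedAddCommGroup H₂] [InnerProductSpace ℝ H₂] {Ξ : Type*} [MeasurableSpace Ξ]
  {P : Measure Ξ} [IsProbabilityMeasure P]

theorem norm_integral_sub_integral_le {E : Type*} [NormedAddCommGroup E] [NormedSpace ℝ E]
    {φ ψ : Ξ → E} (hφ : Integrable φ P) (hψ : Integrable ψ P) {K : ℝ}
    (h : ∀ᵐ ξ ∂P, ‖φ ξ - ψ ξ‖ ≤ K) : ‖∫ ξ, φ ξ ∂P - ∫ ξ, ψ ξ ∂P‖ ≤ K := by
  rw [← integral_sub hφ hψ]
  simpa using norm_integral_le_of_norm_le_const h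

theorem strongConvexOn_integral {H : Type*} [NormedAddCommGroup H] [NormedSpace ℝ H] {X : Set H}
    {m : ℝ} {Φ : H → Ξ → ℝ} (hX : Convex ℝ X) (hint : ∀ x ∈ X, Integrable (Φ x) P)
    (h : ∀ ξ, StrongConvexOn X m (fun x => Φ x ξ)) :
    StrongConvexOn X m (fun x => ∫ ξ, Φ x ξ ∂P) := by
  refine ⟨hX, fun x hx y hy a b ha hb hab => ?_⟩
  have h1 := (hint x hx).const_mul a
  have h2 := (hint y hy).const_mul b
  have h3 : Integrable (fun _ : Ξ => a * b * (m / 2 * ‖x - y‖ ^ 2)) P := integrable_const _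
  have h12 : Integrable (fun ξ => a * Φ x ξ + b * Φ y ξ) P := h1.add h2
  calc ∫ ξ, Φ (a • x + b • y) ξ ∂P
      ≤ ∫ ξ, (a * Φ x ξ + b * Φ y ξ - a * b * (m / 2 * ‖x - y‖ ^ 2)) ∂P :=
        integral_mono (hint _ (hX hx hy ha hb hab)) (h12.sub h3) fun ξ =>
          (h ξ).2 hx hy ha hb hab
    _ = _ := by
        rw [integral_sub h12 h3, integral_add h1 h2, integral_const_mul,
          integral_const_mul]
        simp

theorem strongConcaveOn_integral {H : Type*} [NormedAddCommGroup H] [NormedSpace ℝ H] {X : Set H}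
    {m : ℝ} {Φ : H → Ξ → ℝ} (hX : Convex ℝ X) (hint : ∀ x ∈ X, Integrable (Φ x) P)
    (h : ∀ ξ, StrongConcaveOn X m (fun x => Φ x ξ)) :
    StrongConcaveOn X m (fun x => ∫ ξ, Φ x ξ ∂P) := by
  have h1 := (strongConvexOn_integral (P := P) (m := m) (Φ := fun x ξ => -Φ x ξ) hX
    (fun x hx => (hint x hx).neg) (fun ξ => (h ξ).neg)).neg
  simp only [integral_neg, Pi.neg_def, neg_neg] at h1
  exact h1

/-- The constants do not depend on `ξ`, and all these inequalities survive averaging: the convexity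
ones are linear in the function, and the Lipschitz ones follow from the norm of an integral being at
most the almost sure bound. -/
theorem halfRegular_integral {X : Set H₁} {Y : Set H₂} {Φ : H₁ → H₂ → Ξ → ℝ}
    {G : H₁ → H₂ → Ξ → H₁} {L Lc m₁ m₂ D : ℝ} (hXc : IsCompact X) (hX : Convex ℝ X)
    (hY : Convex ℝ Y) (hL : 0 ≤ L) (hLc : 0 ≤ Lc) (hD : 0 ≤ D)
    (hdiam : ∀ u ∈ X, ∀ v ∈ X, ‖u - v‖ ≤ D)
    (hint : ∀ x ∈ X, ∀ y ∈ Y, Integrable (Φ x y) P)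
    (hGint : ∀ x ∈ X, ∀ y ∈ Y, Integrable (G x y) P)
    (hgrad : ∀ x ∈ X, ∀ y ∈ Y, HasGradientAt (fun x' => ∫ ξ, Φ x' y ξ ∂P) (∫ ξ, G x y ξ ∂P) x)
    (hlip : ∀ᵐ ξ ∂P, ∀ x₁ ∈ X, ∀ x₂ ∈ X, ∀ y ∈ Y, ‖G x₁ y ξ - G x₂ y ξ‖ ≤ L * ‖x₁ - x₂‖)
    (hcross : ∀ᵐ ξ ∂P, ∀ x ∈ X, ∀ y₁ ∈ Y, ∀ y₂ ∈ Y, ‖G x y₁ ξ - G x y₂ ξ‖ ≤ Lc * ‖y₁ - y₂‖)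
    (hconv : ∀ ξ, ∀ y ∈ Y, StrongConvexOn X m₁ (fun x => Φ x y ξ))
    (hconc : ∀ ξ, ∀ x ∈ X, StrongConcaveOn Y m₂ (fun y => Φ x y ξ)) :
    HalfRegular X Y (fun x y => ∫ ξ, Φ x y ξ ∂P) (fun x y => ∫ ξ, G x y ξ ∂P) L Lc m₁ m₂ D where
  compact := hXc
  L_nonneg := hL
  Lc_nonneg := hLc
  D_nonneg := hD
  diam := hdiam
  grad := hgrad
  lip x₁ h₁ x₂ h₂ y hy := norm_integral_sub_integral_le (hGint x₁ h₁ y hy) (hGint x₂ h₂ y hy)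
    (hlip.mono fun _ h => h x₁ h₁ x₂ h₂ y hy)
  cross x hx y₁ h₁ y₂ h₂ := norm_integral_sub_integral_le (hGint x hx y₁ h₁) (hGint x hx y₂ h₂)
    (hcross.mono fun _ h => h x hx y₁ h₁ y₂ h₂)
  convex y hy := strongConvexOn_integral hX (fun x hx => hint x hx y hy) fun ξ => hconv ξ y hy
  concave x hx := strongConcaveOn_integral hY (fun y hy => hint x hx y hy) fun ξ => hconc ξ x hx

end Mean

/-! ### The mean function of one round -/

section Problem

variable {dX dY : ℕ} {Ξ : Type*} [MeasurableSpace Ξ] {P : Measure Ξ}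

/-- The mean of the stochastic partial gradient `∇ₓF`. -/
noncomputable def meanGradX (P : Measure Ξ) (F : E dX → E dY → Ξ → ℝ) (x : E dX) (y : E dY) :
    E dX :=
  ∫ ξ, gradX (atNoise F ξ) x y ∂P

/-- The mean of the stochastic partial gradient `∇_yF`. -/
noncomputable def meanGradY (P : Measure Ξ) (F : E dX → E dY → Ξ → ℝ) (x : E dX) (y : E dY) :
    E dY :=
  ∫ ξ, gradY (atNoise F ξ) x y ∂P

variable {c : Constants} {X : Set (E dX)} {Y : Set (E dY)} {F : E dX → E dY → Ξ → ℝ} {σ : ℝ}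

theorem StochasticOracle.gradX_mean (h : StochasticOracle P σ X Y F) {x : E dX} {y : E dY}
    (hx : x ∈ X) (hy : y ∈ Y) : gradX (mean P F) x y = meanGradX P F x y :=
  (h.unbiased_x x hx y hy).gradient

theorem StochasticOracle.gradY_mean (h : StochasticOracle P σ X Y F) {x : E dX} {y : E dY}
    (hx : x ∈ X) (hy : y ∈ Y) : gradY (mean P F) x y = meanGradY P F x y :=
  (h.unbiased_y x hx y hy).gradient

/-- The assumptions on one round: the sets, the regularity of the random function and the
stochastic oracle. -/
structure RoundAssumptions (c : Constants) (P : Measure Ξ) (σ : ℝ) (X : Set (E dX))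
    (Y : Set (E dY)) (F : E dX → E dY → Ξ → ℝ) : Prop where
  valid : c.Valid
  compactX : IsCompact X
  convexX : Convex ℝ X
  compactY : IsCompact Y
  convexY : Convex ℝ Y
  diamX : ∀ x ∈ X, ∀ x' ∈ X, ‖x - x'‖ ≤ c.DX
  diamY : ∀ y ∈ Y, ∀ y' ∈ Y, ‖y - y'‖ ≤ c.DY
  measurable : Measurable (fun p : E dX × E dY × Ξ => F p.1 p.2.1 p.2.2)
  scc : StronglyConvexConcave c X Y F
  lipFun : LipschitzFunction c P X Y F
  lipGrad : LipschitzGradient c P X Y F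
  lipPartial : LipschitzPartialGradient c P X Y F
  oracle : StochasticOracle P σ X Y F

theorem InteriorSaddlePoint.meanGradX_eq_zero (h : RoundAssumptions c P σ X Y F) {xs : E dX}
    {ys : E dY} (hs : InteriorSaddlePoint c X Y (mean P F) xs ys) : meanGradX P F xs ys = 0 := by
  have hxs := interior_subset hs.mem_x
  have hys := interior_subset hs.mem_y
  have hmin : IsLocalMin (fun x => mean P F x ys) xs := by
    filter_upwards [mem_interior_iff_mem_nhds.1 hs.mem_x] with x hx
    exact hs.saddle x hx ys hys
  exact (LinearIsometryEquiv.map_eq_zero_iff _).1 (hmin.hasFDerivAt_eq_zero (h.oracle.unbiased_x xs hxs ys hys).hasFDerivAt)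

theorem InteriorSaddlePoint.meanGradY_eq_zero (h : RoundAssumptions c P σ X Y F) {xs : E dX}
    {ys : E dY} (hs : InteriorSaddlePoint c X Y (mean P F) xs ys) : meanGradY P F xs ys = 0 := by
  have hxs := interior_subset hs.mem_x
  have hys := interior_subset hs.mem_y
  have hmax : IsLocalMax (fun y => mean P F xs y) ys := by
    filter_upwards [mem_interior_iff_mem_nhds.1 hs.mem_y] with y hy
    exact hs.saddle xs hxs y hy
  exact (LinearIsometryEquiv.map_eq_zero_iff _).1 (hmax.hasFDerivAt_eq_zero (h.oracle.unbiased_y xs hxs ys hys).hasFDerivAt)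

variable [IsProbabilityMeasure P]

theorem RoundAssumptions.regular (h : RoundAssumptions c P σ X Y F) :
    Regular X Y (mean P F) (meanGradX P F) (meanGradY P F) c.LGX c.LGY c.LXY c.LYX c.muX c.muY
      c.DX c.DY where
  left := halfRegular_integral h.compactX h.convexX h.convexY h.valid.LGX_nonneg
    h.valid.LXY_nonneg h.valid.DX_nonneg h.diamX h.oracle.integrable h.oracle.integrable_gradX
    h.oracle.unbiased_x (h.lipGrad.mono fun _ k x₁ _ x₂ _ y hy => k.1 x₁ x₂ y hy)
    (h.lipPartial.mono fun _ k => k.1) h.scc.convex h.scc.concave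
  right := by
    -- Negating and exchanging the variables turns the concave block into a convex one.
    have key := halfRegular_integral (P := P) (Φ := fun y x ξ => -F x y ξ)
      (G := fun y x ξ => -gradY (atNoise F ξ) x y) (m₁ := c.muY) (m₂ := c.muX) h.compactY
      h.convexY h.convexX
      h.valid.LGY_nonneg h.valid.LYX_nonneg h.valid.DY_nonneg h.diamY
      (fun y hy x hx => (h.oracle.integrable x hx y hy).neg)
      (fun y hy x hx => (h.oracle.integrable_gradY x hx y hy).neg)
      (fun y hy x hx => by
        have h1 := (h.oracle.unbiased_y x hx y hy).hasFDerivAt.neg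
        rw [← map_neg] at h1
        simp only [integral_neg]
        exact h1)
      (h.lipGrad.mono fun _ k y₁ _ y₂ _ x hx => by
        rw [← neg_sub', norm_neg]
        exact k.2 x hx y₁ y₂)
      (h.lipPartial.mono fun _ k y hy x₁ h₁ x₂ h₂ => by
        rw [← neg_sub', norm_neg]
        exact k.2 x₁ h₁ x₂ h₂ y hy)
      (fun ξ x hx => (h.scc.concave ξ x hx).neg) (fun ξ y hy => (h.scc.convex ξ y hy).neg)
    simp only [integral_neg] at key
    exact key

theorem RoundAssumptions.mean_lipschitzX (h : RoundAssumptions c P σ X Y F) :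
    ∀ x₁ ∈ X, ∀ x₂ ∈ X, ∀ y ∈ Y, |mean P F x₁ y - mean P F x₂ y| ≤ c.LX * ‖x₁ - x₂‖ :=
  fun x₁ h₁ x₂ h₂ y hy => norm_integral_sub_integral_le (h.oracle.integrable x₁ h₁ y hy)
    (h.oracle.integrable x₂ h₂ y hy) (h.lipFun.mono fun _ k => k.1 x₁ h₁ x₂ h₂ y hy)

theorem RoundAssumptions.mean_lipschitzY (h : RoundAssumptions c P σ X Y F) :
    ∀ x ∈ X, ∀ y₁ ∈ Y, ∀ y₂ ∈ Y, |mean P F x y₁ - mean P F x y₂| ≤ c.LY * ‖y₁ - y₂‖ :=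
  fun x hx y₁ h₁ y₂ h₂ => norm_integral_sub_integral_le (h.oracle.integrable x hx y₁ h₁)
    (h.oracle.integrable x hx y₂ h₂) (h.lipFun.mono fun _ k => k.2 x hx y₁ h₁ y₂ h₂)

theorem RoundAssumptions.abs_mean_sub_le (h : RoundAssumptions c P σ X Y F) {x x' : E dX}
    {y y' : E dY} (hx : x ∈ X) (hx' : x' ∈ X) (hy : y ∈ Y) (hy' : y' ∈ Y) :
    |mean P F x y - mean P F x' y'| ≤ c.LX * c.DX + c.LY * c.DY := by
  have h1 := h.mean_lipschitzX x hx x' hx' y hy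
  have h2 := h.mean_lipschitzY x' hx' y hy y' hy'
  have h3 := mul_le_mul_of_nonneg_left (h.diamX x hx x' hx') h.valid.LX_nonneg
  have h4 := mul_le_mul_of_nonneg_left (h.diamY y hy y' hy') h.valid.LY_nonneg
  have := abs_sub_le (mean P F x y) (mean P F x' y) (mean P F x' y')
  linarith

/-- The content is that the supremum in `supDist` is finite: each mean oscillates by at most `L_X
D_X + L_Y D_Y`, so the difference is bounded in terms of its value at one point. -/
theorem le_supDist {F' : E dX → E dY → Ξ → ℝ} (h : RoundAssumptions c P σ X Y F)
    (h' : RoundAssumptions c P σ X Y F') : ∀ x ∈ X, ∀ y ∈ Y,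
      |mean P F x y - mean P F' x y| ≤ supDist X Y (mean P F) (mean P F') := by
  intro x hx y hy
  refine le_csSup ⟨|mean P F x y - mean P F' x y| + 2 * (c.LX * c.DX + c.LY * c.DY), ?_⟩
    ⟨(x, y), ⟨hx, hy⟩, rfl⟩
  rintro _ ⟨⟨x', y'⟩, ⟨hx', hy'⟩, rfl⟩
  have h1 := h.abs_mean_sub_le hx' hx hy' hy
  have h2 := h'.abs_mean_sub_le hx hx' hy hy'
  have h3 := abs_sub_le (mean P F x' y') (mean P F x y) (mean P F' x' y')
  have h4 := abs_sub_le (mean P F x y) (mean P F' x y) (mean P F' x' y')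
  simp only at hx' hy' ⊢
  linarith

/-- The open ball is connected, misses the frontier and meets the interior, hence cannot reach the
complement; closedness of `X` then gives the closed ball. -/
theorem closedBall_subset_of_le_infDist_frontier {H : Type*} [NormedAddCommGroup H]
    [NormedSpace ℝ H] {X : Set H} (hX : IsClosed X) {x : H} (hx : x ∈ interior X) {δ : ℝ}
    (hδ : δ ≤ Metric.infDist x (frontier X)) (h0 : 0 < δ) : Metric.closedBall x δ ⊆ X := by
  rw [← closure_ball x h0.ne']
  refine hX.closure_subset_iff.2 ?_
  have hd : Disjoint (Metric.ball x δ) (frontier X) :=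
    (Metric.disjoint_ball_infDist).mono_left (Metric.ball_subset_ball hδ)
  have hc : IsPreconnected (Metric.ball x δ) := (convex_ball x δ).isPreconnected
  intro y hy
  by_contra hyX
  obtain ⟨z, -, hz, hz'⟩ := hc (interior X) Xᶜ isOpen_interior hX.isOpen_compl (fun z hz => by
    by_contra hn
    rw [Set.mem_union, not_or, Set.notMem_compl_iff] at hn
    exact hd.ne_of_mem hz ⟨subset_closure hn.2, hn.1⟩ rfl) ⟨x, Metric.mem_ball_self h0, hx⟩
    ⟨y, hy, hyX⟩
  exact hz' (interior_subset hz)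

/-- The gradient vanishes at an interior saddle point, so its size elsewhere is controlled by the
two Lipschitz constants and the diameters. The bound on the second moment of the finite differences
needs this. -/
theorem HalfRegular.norm_le {X : Set (E dX)} {Y : Set (E dY)} {f : E dX → E dY → ℝ}
    {g : E dX → E dY → E dX} {L Lc m₁ m₂ D D' : ℝ} (h : HalfRegular X Y f g L Lc m₁ m₂ D)
    (hD' : ∀ u ∈ Y, ∀ v ∈ Y, ‖u - v‖ ≤ D') {xs x : E dX} {ys y : E dY} (hxs : xs ∈ X) (hx : x ∈ X)
    (hys : ys ∈ Y) (hy : y ∈ Y) (h0 : g xs ys = 0) : ‖g x y‖ ≤ L * D + Lc * D' := by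
  have h1 := (h.lip x hx xs hxs y hy).trans
    (mul_le_mul_of_nonneg_left (h.diam x hx xs hxs) h.L_nonneg)
  have h2 := (h.cross xs hxs y hy ys hys).trans
    (mul_le_mul_of_nonneg_left (hD' y hy ys hys) h.Lc_nonneg)
  have h3 := norm_sub_le_norm_sub_add_norm_sub (g x y) (g xs y) (g xs ys)
  rw [h0, sub_zero] at h3
  rw [h0] at h2
  linarith

theorem InteriorSaddlePoint.norm_meanGradX_le (h : RoundAssumptions c P σ X Y F) {xs : E dX}
    {ys : E dY} (hs : InteriorSaddlePoint c X Y (mean P F) xs ys) {x : E dX} {y : E dY}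
    (hx : x ∈ X) (hy : y ∈ Y) : ‖meanGradX P F x y‖ ≤ c.LGX * c.DX + c.LXY * c.DY :=
  h.regular.left.norm_le h.diamY (interior_subset hs.mem_x) hx (interior_subset hs.mem_y) hy
    (hs.meanGradX_eq_zero h)

theorem InteriorSaddlePoint.norm_meanGradY_le (h : RoundAssumptions c P σ X Y F) {xs : E dX}
    {ys : E dY} (hs : InteriorSaddlePoint c X Y (mean P F) xs ys) {x : E dX} {y : E dY}
    (hx : x ∈ X) (hy : y ∈ Y) : ‖meanGradY P F x y‖ ≤ c.LGY * c.DY + c.LYX * c.DX := by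
  have := h.regular.right.norm_le h.diamX (interior_subset hs.mem_y) hy (interior_subset hs.mem_x)
    hx (by rw [hs.meanGradY_eq_zero h, neg_zero])
  rwa [norm_neg] at this

end Problem

/-! ### The constants of the contraction -/

section Constants

variable {c : Constants}

theorem Constants.Valid.deltaMu_pos (hc : c.Valid) : 0 < c.deltaMu := by
  have := hc.muX_pos; have := hc.muY_pos; have := hc.deltaX_pos; have := hc.deltaY_pos
  exact Real.sqrt_pos.2 (lt_min (by positivity) (by positivity))

theorem Constants.Valid.deltaMu_le_X (hc : c.Valid) : c.deltaMu ≤ c.deltaX * √c.muX := by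
  have := hc.muX_pos; have := hc.deltaX_pos
  rw [Constants.deltaMu, Real.sqrt_le_left (by positivity), mul_pow, Real.sq_sqrt hc.muX_pos.le,
    mul_comm (c.deltaX ^ 2)]
  exact min_le_left _ _

theorem Constants.Valid.deltaMu_le_Y (hc : c.Valid) : c.deltaMu ≤ c.deltaY * √c.muY := by
  have := hc.muY_pos; have := hc.deltaY_pos
  rw [Constants.deltaMu, Real.sqrt_le_left (by positivity), mul_pow, Real.sq_sqrt hc.muY_pos.le,
    mul_comm (c.deltaY ^ 2)]
  exact min_le_right _ _

/-- This is the form in which the assumption on `C₀` enters: coupling at most `δ_μ`, against a gain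
of `√2 δ_μ`. -/
theorem Constants.Valid.sqrt_two_mul_max_le (hc : c.Valid) (h0 : 0 ≤ c.C0) :
    √2 * max (c.DX * c.LXY / √c.muY) (c.DY * c.LYX / √c.muX) ≤ c.deltaMu := by
  have := sub_nonneg.1 h0
  rwa [div_mul_eq_mul_div, div_le_one hc.deltaMu_pos] at this

/-- An upper bound for the duality gaps. -/
noncomputable def Constants.gapBound (c : Constants) : ℝ := c.LX * c.DX + c.LY * c.DY + 1

/-- The constant of the quadratic term of a conditional-gradient step. -/
noncomputable def Constants.curvature (c : Constants) : ℝ :=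
  (c.LGX + c.LXY ^ 2 / c.muY) * c.DX ^ 2 + (c.LGY + c.LYX ^ 2 / c.muX) * c.DY ^ 2

/-- The contraction rate of the duality gap per unit of step size. -/
noncomputable def Constants.rate (c : Constants) : ℝ := (√2 - 1) * c.deltaMu / √c.gapBound

/-- The constant of the pathwise regret bound. -/
noncomputable def Constants.pathConst (c : Constants) : ℝ :=
  c.gapBound * (c.gapBound + c.curvature + c.DX ^ 2 + c.DY ^ 2 + 1) / c.rate

/-- The summand `1` in `gapBound` secures positivity when the Lipschitz constants or diameters
vanish, so that dividing by its root in `rate` is harmless. -/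
theorem Constants.Valid.gapBound_pos (hc : c.Valid) : 0 < c.gapBound := by
  have := mul_nonneg hc.LX_nonneg hc.DX_nonneg
  have := mul_nonneg hc.LY_nonneg hc.DY_nonneg
  unfold Constants.gapBound
  positivity

theorem Constants.Valid.curvature_nonneg (hc : c.Valid) : 0 ≤ c.curvature := by
  have := hc.LGX_nonneg; have := hc.LGY_nonneg; have := hc.muX_pos; have := hc.muY_pos
  unfold Constants.curvature
  positivity

theorem Constants.Valid.rate_pos (hc : c.Valid) : 0 < c.rate := by
  have h1 : 0 < √2 - 1 := sub_pos.2 (Real.lt_sqrt_of_sq_lt (by norm_num))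
  have h2 := hc.deltaMu_pos
  have h3 := Real.sqrt_pos.2 hc.gapBound_pos
  unfold Constants.rate
  positivity

theorem Constants.Valid.pathConst_pos (hc : c.Valid) : 0 < c.pathConst := by
  have h1 := hc.gapBound_pos
  have h2 := hc.curvature_nonneg
  have h3 := hc.rate_pos
  unfold Constants.pathConst
  positivity

end Constants

/-! ### The step size -/

section StepSize

variable {T : ℕ} {M : ℝ}

/-- The step size is chosen so that the second-order terms of all rounds together are of the order
of the variation budget. -/
theorem stepSize_sq_mul (hT : 1 ≤ T) (hM : 0 ≤ M) : (T : ℝ) * stepSize T M ^ 2 = M := by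
  have : (0 : ℝ) < T := by exact_mod_cast hT
  rw [stepSize, Real.sq_sqrt (by positivity)]
  field_simp

theorem stepSize_pos (hT : 1 ≤ T) (hM : 0 < M) : 0 < stepSize T M := by
  have : (0 : ℝ) < T := by exact_mod_cast hT
  exact Real.sqrt_pos.2 (by positivity)

theorem stepSize_le_one (hT : 1 ≤ T) (hM : M ≤ T) : stepSize T M ≤ 1 := by
  have : (0 : ℝ) < T := by exact_mod_cast hT
  rw [stepSize, Real.sqrt_le_one, div_le_one this]
  exact hM

end StepSize

/-! ### The regret bound on a single path -/

section Pathwise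

variable {dX dY : ℕ} {Ξ : Type*} [MeasurableSpace Ξ] {P : Measure Ξ}
  {c : Constants} {X : Set (E dX)} {Y : Set (E dY)} {F : ℕ → E dX → E dY → Ξ → ℝ} {σ : ℝ}
  {lmo : ℕ → E dX × E dY → E dX × E dY} {est : ℕ → E dX × E dY → (E dX × E dY) × ℕ}
  {z₁ : E dX × E dY} {γ : ℝ}

theorem fwState_mem (hX : Convex ℝ X) (hY : Convex ℝ Y) (hγ : 0 ≤ γ) (hγ1 : γ ≤ 1)
    (hlmo : ∀ t, IsLMO X Y (lmo t)) (hz : z₁ ∈ X ×ˢ Y) (n : ℕ) :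
    (fwState γ lmo est z₁ n).1 ∈ X ×ˢ Y := by
  induction n with
  | zero => exact hz
  | succ n ih =>
    exact (hX.prod hY) ih ((hlmo _).mem _) (sub_nonneg.2 hγ1) hγ (by ring)

theorem played_mem (hX : Convex ℝ X) (hY : Convex ℝ Y) (hγ : 0 ≤ γ) (hγ1 : γ ≤ 1)
    (hlmo : ∀ t, IsLMO X Y (lmo t)) (hz : z₁ ∈ X ×ˢ Y) (t : ℕ) :
    played γ lmo est z₁ t ∈ X ×ˢ Y :=
  fwState_mem hX hY hγ hγ1 hlmo hz _

/-- Rounds start at `1`: the truncated subtraction in `played` makes rounds `0` and `1` share the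
initial point, so `1 ≤ t` is essential. -/
theorem played_succ {t : ℕ} (ht : 1 ≤ t) : played γ lmo est z₁ (t + 1) =
    played γ lmo est z₁ t + γ • (lmo t ((est t (played γ lmo est z₁ t)).1.1,
      -(est t (played γ lmo est z₁ t)).1.2) - played γ lmo est z₁ t) := by
  obtain ⟨n, rfl⟩ : ∃ n, t = n + 1 := ⟨t - 1, by omega⟩
  simp only [played, Nat.add_sub_cancel, fwState]
  module

theorem IsLMO.fst_le {l : E dX × E dY → E dX × E dY} (h : IsLMO X Y l) (r : E dX × E dY) :
    ∀ v ∈ X, ⟪(l r).1, r.1⟫_ℝ ≤ ⟪v, r.1⟫_ℝ := fun v hv => by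
  have := h.le r (v, (l r).2) ⟨hv, (h.mem r).2⟩
  simpa using this

theorem IsLMO.snd_le {l : E dX × E dY → E dX × E dY} (h : IsLMO X Y l) (r : E dX × E dY) :
    ∀ v ∈ Y, ⟪(l r).2, r.2⟫_ℝ ≤ ⟪v, r.2⟫_ℝ := fun v hv => by
  have := h.le r ((l r).1, v) ⟨(h.mem r).1, hv⟩
  simpa using this

/-- The squared error of a gradient estimate `G` at the point `z`. -/
noncomputable def sqError (P : Measure Ξ) (F : E dX → E dY → Ξ → ℝ) (z G : E dX × E dY) : ℝ :=
  ‖G.1 - meanGradX P F z.1 z.2‖ ^ 2 + ‖G.2 - meanGradY P F z.1 z.2‖ ^ 2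

theorem sqError_nonneg (F : E dX → E dY → Ξ → ℝ) (z G : E dX × E dY) : 0 ≤ sqError P F z G := by
  unfold sqError
  positivity

variable [IsProbabilityMeasure P]

/-- The pathwise regret bound of the Frank-Wolfe method with arbitrary gradient estimates. -/
theorem meritLoss_le (hc : c.Valid) (hC0 : 0 ≤ c.C0) {T : ℕ} (hT : 1 ≤ T) {M W : ℝ} (hM : 0 < M)
    (hMT : M ≤ T) (hW : 2 * W ≤ M)
    (hF : ∀ t ∈ Finset.Icc 1 T, RoundAssumptions c P σ X Y (F t)) {xs : ℕ → E dX} {ys : ℕ → E dY}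
    (hs : ∀ t ∈ Finset.Icc 1 T, InteriorSaddlePoint c X Y (mean P (F t)) (xs t) (ys t))
    (hvar : FunctionVariationLE T W X Y (fun t => mean P (F t)))
    (hlmo : ∀ t, IsLMO X Y (lmo t)) (hz : z₁ ∈ X ×ˢ Y) :
    meritLoss (fun t => mean P (F t)) xs ys T (played (stepSize T M) lmo est z₁) ≤
      c.pathConst / stepSize T M * (1 + M + ∑ t ∈ Finset.Icc 1 T,
        sqError P (F t) (played (stepSize T M) lmo est z₁ t)
          (est t (played (stepSize T M) lmo est z₁ t)).1) := by
  have hγ := stepSize_pos hT hM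
  have hγ1 := stepSize_le_one hT hMT
  have hTγ := stepSize_sq_mul hT hM.le
  have h1T : 1 ∈ Finset.Icc 1 T := Finset.mem_Icc.2 ⟨le_rfl, hT⟩
  have hX := (hF 1 h1T).convexX
  have hY := (hF 1 h1T).convexY
  set γ := stepSize T M
  have hmem : ∀ t, played γ lmo est z₁ t ∈ X ×ˢ Y := played_mem hX hY hγ.le hγ1 hlmo hz
  have hsucc : ∀ t, 1 ≤ t → _ := fun t ht => played_succ (γ := γ) (lmo := lmo) (est := est)
    (z₁ := z₁) (t := t) ht
  set z := played γ lmo est z₁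
  set err := fun t => sqError P (F t) (z t) (est t (z t)).1
  set gap := fun (t : ℕ) (p : E dX × E dY) => dualityGap X Y (mean P (F t)) p.1 p.2
  have hH := hc.gapBound_pos
  have hgap_le : ∀ t ∈ Finset.Icc 1 T, ∀ p ∈ X ×ˢ Y, gap t p ≤ c.gapBound := fun t ht p hp => by
    have := (hF t ht).regular.dualityGap_le hp.1 hp.2 hc.LX_nonneg hc.LY_nonneg
      (hF t ht).mean_lipschitzX (hF t ht).mean_lipschitzY
    exact this.trans (by simp [Constants.gapBound])
  have hgap_nonneg : ∀ t ∈ Finset.Icc 1 T, ∀ p ∈ X ×ˢ Y, 0 ≤ gap t p := fun t ht p hp =>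
    (hF t ht).regular.dualityGap_nonneg hp.1 hp.2
  have hmax := hc.sqrt_two_mul_max_le hC0
  have h21 : 0 ≤ √2 - 1 := sub_nonneg.2 (Real.one_le_sqrt.2 (by norm_num))
  have hstep : ∀ t ∈ Finset.Icc 1 T, gap t (z (t + 1)) ≤ gap t (z t) - (γ * c.rate) * gap t (z t)
      + (γ ^ 2 * (c.DX ^ 2 + c.DY ^ 2) + err t) + γ ^ 2 * c.curvature := fun t ht => by
    have hL := hlmo t
    set G := (est t (z t)).1
    set s := lmo t (G.1, -G.2)
    have hsad := hs t ht
    have hb₁ := closedBall_subset_of_le_infDist_frontier (hF t ht).compactX.isClosed hsad.mem_x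
      hsad.border_x hc.deltaX_pos
    have hb₂ := closedBall_subset_of_le_infDist_frontier (hF t ht).compactY.isClosed hsad.mem_y
      hsad.border_y hc.deltaY_pos
    have h1 := (hF t ht).regular.dualityGap_step_le hX hY hc.muX_pos hc.muY_pos hγ.le hγ1
      (hmem t).1 (hL.mem (G.1, -G.2)).1 (hmem t).2 (hL.mem (G.1, -G.2)).2 hc.deltaX_pos.le
      hc.deltaY_pos.le hb₁ hb₂ hsad.saddle (hL.fst_le (G.1, -G.2)) (hL.snd_le (G.1, -G.2))
      hc.deltaMu_pos.le
      ((mul_le_mul_of_nonneg_left (le_max_left _ _) (Real.sqrt_nonneg 2)).trans hmax)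
      ((mul_le_mul_of_nonneg_left (le_max_right _ _) (Real.sqrt_nonneg 2)).trans hmax)
      hc.deltaMu_le_X hc.deltaMu_le_Y
    have h2 := mul_div_sqrt_le (mul_nonneg h21 hc.deltaMu_pos.le) (hgap_nonneg t ht _ (hmem t)) hH
      (hgap_le t ht _ (hmem t))
    have h3 := mul_le_mul_of_nonneg_left h2 hγ.le
    have h4 : gap t (z (t + 1)) = dualityGap X Y (mean P (F t))
        ((z t).1 + γ • (s.1 - (z t).1)) ((z t).2 + γ • (s.2 - (z t).2)) := by
      rw [hsucc t (Finset.mem_Icc.1 ht).1]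
      rfl
    -- The inequality `2ab ≤ a² + b²` with `a = γ D` and `b` the error norm: the first square sums
    -- to `O(M)` and the second is the mean squared error.
    have h5 : γ * (c.DX * ‖G.1 - meanGradX P (F t) (z t).1 (z t).2‖
        + c.DY * ‖G.2 - meanGradY P (F t) (z t).1 (z t).2‖) ≤
        γ ^ 2 * (c.DX ^ 2 + c.DY ^ 2) + err t := by
      change _ ≤ _ + (‖G.1 - meanGradX P (F t) (z t).1 (z t).2‖ ^ 2 +
        ‖G.2 - meanGradY P (F t) (z t).1 (z t).2‖ ^ 2)
      nlinarith [two_mul_le_add_sq (γ * c.DX) ‖G.1 - meanGradX P (F t) (z t).1 (z t).2‖,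
        two_mul_le_add_sq (γ * c.DY) ‖G.2 - meanGradY P (F t) (z t).1 (z t).2‖,
        sq_nonneg (γ * c.DX), sq_nonneg (γ * c.DY),
        sq_nonneg ‖G.1 - meanGradX P (F t) (z t).1 (z t).2‖,
        sq_nonneg ‖G.2 - meanGradY P (F t) (z t).1 (z t).2‖]
    rw [h4]
    have h6 : γ * c.rate * gap t (z t) = γ * ((√2 - 1) * c.deltaMu / √c.gapBound * gap t (z t)) := by
      rw [Constants.rate, mul_assoc]
    rw [h6]
    change _ ≤ _ + γ ^ 2 * _ at h1
    unfold Constants.curvature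
    linarith
  have hdrift : ∀ t ∈ Finset.Ico 1 T, gap (t + 1) (z (t + 1)) ≤ gap t (z (t + 1)) +
      2 * supDist X Y (mean P (F t)) (mean P (F (t + 1))) := fun t ht => by
    rw [Finset.mem_Ico] at ht
    have ht1 : t ∈ Finset.Icc 1 T := Finset.mem_Icc.2 ⟨ht.1, ht.2.le⟩
    have ht2 : t + 1 ∈ Finset.Icc 1 T := Finset.mem_Icc.2 ⟨by omega, ht.2⟩
    exact (hF t ht1).regular.dualityGap_le_add (hF _ ht2).regular (hmem _).1 (hmem _).2
      (le_supDist (hF t ht1) (hF _ ht2))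
  have hsum := sum_le_of_contraction hT hstep hdrift
    (hgap_nonneg T (Finset.mem_Icc.2 ⟨hT, le_rfl⟩) _ (hmem _))
  have h1 := hgap_le 1 h1T _ (hmem 1)
  have herr : 0 ≤ ∑ t ∈ Finset.Icc 1 T, err t :=
    Finset.sum_nonneg fun t _ => sqError_nonneg _ _ _
  rw [← Finset.mul_sum, Finset.sum_add_distrib, Finset.sum_const, Nat.card_Icc,
    Nat.add_sub_cancel, nsmul_eq_mul, ← mul_assoc, ← mul_assoc, hTγ] at hsum
  have hW' : 2 * ∑ t ∈ Finset.Ico 1 T, supDist X Y (mean P (F t)) (mean P (F (t + 1))) ≤ M :=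
    (mul_le_mul_of_nonneg_left hvar zero_le_two).trans hW
  set S := ∑ t ∈ Finset.Icc 1 T, err t
  have hr := hc.rate_pos
  have hK := hc.curvature_nonneg
  have hgapsum : ∑ t ∈ Finset.Icc 1 T, gap t (z t) ≤
      (c.gapBound + c.curvature + c.DX ^ 2 + c.DY ^ 2 + 1) * (1 + M + S) / (γ * c.rate) := by
    rw [le_div_iff₀' (by positivity)]
    have e1 : 0 ≤ c.gapBound * (M + S) := by positivity
    have e2 : 0 ≤ c.curvature * (1 + S) := by positivity
    have e3 : 0 ≤ (c.DX ^ 2 + c.DY ^ 2) * (1 + S) := by positivity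
    nlinarith
  -- In each square one factor is bounded by the constant `gapBound` and the other by the gap
  -- itself.
  have hmerit : meritLoss (fun t => mean P (F t)) xs ys T z ≤
      c.gapBound * ∑ t ∈ Finset.Icc 1 T, gap t (z t) := by
    rw [meritLoss, Finset.mul_sum]
    refine Finset.sum_le_sum fun t ht => ?_
    have k1 := (hF t ht).regular.abs_sub_saddle_le (hmem t).1 (hmem t).2
      (interior_subset (hs t ht).mem_x) (interior_subset (hs t ht).mem_y) (hs t ht).saddle
    rw [← sq_abs, sq]
    exact mul_le_mul (k1.trans (hgap_le t ht _ (hmem t))) k1 (abs_nonneg _) hH.le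
  calc _ ≤ _ := hmerit
    _ ≤ c.gapBound * ((c.gapBound + c.curvature + c.DX ^ 2 + c.DY ^ 2 + 1) * (1 + M + S)
        / (γ * c.rate)) := mul_le_mul_of_nonneg_left hgapsum hH.le
    _ = _ := by
      rw [Constants.pathConst]
      field_simp

end Pathwise

/-! ### Moments of Gaussian vectors -/

section Gaussian

/-- The `k`-th moment of the standard Gaussian distribution on the line. -/
noncomputable def gaussianMoment (k : ℕ) : ℝ := ∫ x, x ^ k ∂(gaussianReal 0 1)

theorem gaussianMoment_nonneg {k : ℕ} (hk : Even k) : 0 ≤ gaussianMoment k :=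
  integral_nonneg fun x => hk.pow_nonneg x

theorem integrable_pow_gaussianReal (k : ℕ) :
    Integrable (fun x : ℝ => x ^ k) (gaussianReal 0 1) := by
  have := (memLp_id_gaussianReal (μ := 0) (v := 1) k).integrable_norm_pow'
  refine this.mono (by fun_prop) (Filter.Eventually.of_forall fun x => ?_)
  simp

variable {d : ℕ}

/-- Reduces moments along a unit vector to moments on the line, which are absolute constants; their
values are never needed. -/
theorem map_inner_stdGaussian {e : E d} (he : ‖e‖ = 1) :
    (stdGaussian (E d)).map (fun u => ⟪e, u⟫_ℝ) = gaussianReal 0 1 := by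
  have h := IsGaussian.map_eq_gaussianReal (μ := stdGaussian (E d)) (innerSL ℝ e)
  rw [integral_strongDual_stdGaussian, variance_dual_stdGaussian, innerSL_apply_norm, he] at h
  simpa using h

theorem integrable_inner_pow_stdGaussian {e : E d} (he : ‖e‖ = 1) (k : ℕ) :
    Integrable (fun u : E d => ⟪e, u⟫_ℝ ^ k) (stdGaussian (E d)) := by
  have := integrable_pow_gaussianReal k
  rw [← map_inner_stdGaussian he] at this
  exact this.comp_measurable (by fun_prop)

theorem integral_inner_pow_stdGaussian {e : E d} (he : ‖e‖ = 1) (k : ℕ) :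
    ∫ u : E d, ⟪e, u⟫_ℝ ^ k ∂(stdGaussian (E d)) = gaussianMoment k := by
  rw [gaussianMoment, ← map_inner_stdGaussian he, integral_map (by fun_prop) (by fun_prop)]

theorem inner_single_one (u : E d) (i : Fin d) :
    ⟪(EuclideanSpace.single i (1 : ℝ) : E d), u⟫_ℝ = u i := by
  simp [EuclideanSpace.inner_single_left]

theorem integrable_norm_pow_stdGaussian (k : ℕ) :
    Integrable (fun u : E d => ‖u‖ ^ k) (stdGaussian (E d)) :=
  (IsGaussian.memLp_id (stdGaussian (E d)) k (by simp)).integrable_norm_pow'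

theorem integral_norm_pow_six_stdGaussian_le :
    ∫ u : E d, ‖u‖ ^ 6 ∂(stdGaussian (E d)) ≤ (d : ℝ) ^ 3 * gaussianMoment 6 := by
  have hint : ∀ i : Fin d, Integrable (fun u : E d => u i ^ 6) (stdGaussian (E d)) := fun i => by
    simpa only [inner_single_one] using integrable_inner_pow_stdGaussian (d := d)
      (e := EuclideanSpace.single i 1) (by simp) 6
  have hval : ∀ i : Fin d, ∫ u : E d, u i ^ 6 ∂(stdGaussian (E d)) = gaussianMoment 6 := fun i => by
    simpa only [inner_single_one] using integral_inner_pow_stdGaussian (d := d)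
      (e := EuclideanSpace.single i 1) (by simp) 6
  calc _ ≤ ∫ u : E d, (d : ℝ) ^ 2 * ∑ i, u i ^ 6 ∂(stdGaussian (E d)) := by
        refine integral_mono (integrable_norm_pow_stdGaussian 6)
          ((integrable_finsetSum _ fun i _ => hint i).const_mul _) fun u => ?_
        -- The power mean inequality `(∑ uᵢ²)³ ≤ d² ∑ uᵢ⁶`; the resulting `d³` is what the smoothing
        -- parameter cancels.
        have h := pow_sum_div_card_le_sum_pow (s := Finset.univ) (f := fun i : Fin d => u i ^ 2)
          (fun i _ => sq_nonneg _) 2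
        rw [← EuclideanSpace.real_norm_sq_eq, Finset.card_univ, Fintype.card_fin] at h
        simp only [← pow_mul] at h ⊢
        rcases Nat.eq_zero_or_pos d with rfl | hd
        · have : u = 0 := Subsingleton.elim _ _
          simp [this]
        · rwa [div_le_iff₀' (by positivity)] at h
    _ = (d : ℝ) ^ 3 * gaussianMoment 6 := by
        rw [integral_const_mul, integral_finsetSum _ fun i _ => hint i]
        simp only [hval, Finset.sum_const, Finset.card_univ, Fintype.card_fin, nsmul_eq_mul]
        ring

theorem integrable_inner_sq_mul_norm_sq (a : E d) :
    Integrable (fun u : E d => ⟪a, u⟫_ℝ ^ 2 * ‖u‖ ^ 2) (stdGaussian (E d)) := by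
  refine ((integrable_norm_pow_stdGaussian (d := d) 4).const_mul (‖a‖ ^ 2)).mono' (by fun_prop)
    (Filter.Eventually.of_forall fun u => ?_)
  rw [Real.norm_eq_abs, abs_of_nonneg (by positivity)]
  have : ⟪a, u⟫_ℝ ^ 2 ≤ (‖a‖ * ‖u‖) ^ 2 := sq_le_sq' (neg_le_of_abs_le (abs_real_inner_le_norm a u))
    (real_inner_le_norm a u)
  nlinarith [sq_nonneg ‖u‖]

/-- With `e = a / ‖a‖`, expand `‖u‖²` in coordinates and use `⟨e, u⟩² uᵢ² ≤ (⟨e, u⟩⁴ + uᵢ⁴) / 2`: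
fourth moments suffice, and the bound is linear in `d`, as a batch of size proportional to `d`
requires. -/
theorem integral_inner_sq_mul_norm_sq_le (a : E d) :
    ∫ u : E d, ⟪a, u⟫_ℝ ^ 2 * ‖u‖ ^ 2 ∂(stdGaussian (E d)) ≤ d * gaussianMoment 4 * ‖a‖ ^ 2 := by
  by_cases ha : a = 0
  · simp [ha]
  have ha' : ‖a‖ ≠ 0 := norm_ne_zero_iff.2 ha
  set e : E d := ‖a‖⁻¹ • a
  have he : ‖e‖ = 1 := norm_smul_inv_norm ha
  have hae : a = ‖a‖ • e := by rw [smul_smul, mul_inv_cancel₀ ha', one_smul]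
  have hint : ∀ i : Fin d, Integrable (fun u : E d => u i ^ 4) (stdGaussian (E d)) := fun i => by
    simpa only [inner_single_one] using integrable_inner_pow_stdGaussian (d := d)
      (e := EuclideanSpace.single i 1) (by simp) 4
  have hval : ∀ i : Fin d, ∫ u : E d, u i ^ 4 ∂(stdGaussian (E d)) = gaussianMoment 4 := fun i => by
    simpa only [inner_single_one] using integral_inner_pow_stdGaussian (d := d)
      (e := EuclideanSpace.single i 1) (by simp) 4
  have hint' := integrable_inner_pow_stdGaussian he 4
  have hsum : ∀ i : Fin d, Integrable (fun u : E d => (⟪e, u⟫_ℝ ^ 4 + u i ^ 4) / 2)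
      (stdGaussian (E d)) := fun i => (hint'.add (hint i)).div_const 2
  calc _ ≤ ∫ u : E d, ‖a‖ ^ 2 * ∑ i, (⟪e, u⟫_ℝ ^ 4 + u i ^ 4) / 2 ∂(stdGaussian (E d)) := by
        refine integral_mono (integrable_inner_sq_mul_norm_sq a)
          ((integrable_finsetSum _ fun i _ => hsum i).const_mul _) fun u => ?_
        have h1 : ⟪a, u⟫_ℝ = ‖a‖ * ⟪e, u⟫_ℝ := by
          rw [← real_inner_smul_left, ← hae]
        simp only [h1]
        rw [mul_pow, mul_assoc, EuclideanSpace.real_norm_sq_eq u]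
        refine mul_le_mul_of_nonneg_left ?_ (sq_nonneg _)
        rw [Finset.mul_sum]
        refine Finset.sum_le_sum fun i _ => ?_
        nlinarith [two_mul_le_add_sq (⟪e, u⟫_ℝ ^ 2) (u i ^ 2)]
    _ = _ := by
        rw [integral_const_mul, integral_finsetSum _ fun i _ => hsum i]
        have : ∀ i : Fin d, ∫ u : E d, (⟪e, u⟫_ℝ ^ 4 + u i ^ 4) / 2 ∂(stdGaussian (E d)) =
            gaussianMoment 4 := fun i => by
          rw [integral_div, integral_add hint' (hint i), hval, integral_inner_pow_stdGaussian he]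
          ring
        simp only [this, Finset.sum_const, Finset.card_univ, Fintype.card_fin, nsmul_eq_mul]
        ring

theorem integrable_inner_smul_stdGaussian (a : E d) :
    Integrable (fun u : E d => ⟪a, u⟫_ℝ • u) (stdGaussian (E d)) := by
  refine ((integrable_norm_pow_stdGaussian (d := d) 2).const_mul ‖a‖).mono' (by fun_prop)
    (Filter.Eventually.of_forall fun u => ?_)
  rw [norm_smul, sq, ← mul_assoc]
  exact mul_le_mul_of_nonneg_right (abs_real_inner_le_norm a u) (norm_nonneg _)

/-- Paired with `b`, this says that the covariance form is the inner product. It makes the linear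
part of the finite-difference estimator unbiased. -/
theorem integral_inner_smul_stdGaussian (a : E d) :
    ∫ u : E d, ⟪a, u⟫_ℝ • u ∂(stdGaussian (E d)) = a := by
  refine ext_inner_left ℝ fun b => ?_
  rw [← integral_inner (integrable_inner_smul_stdGaussian a)]
  have h := covarianceBilin_apply (IsGaussian.memLp_two_id (μ := stdGaussian (E d))) b a
  rw [covarianceBilin_stdGaussian] at h
  simp only [id, integral_id_stdGaussian, sub_zero, innerSL_apply_apply ℝ] at h
  rw [h]
  refine integral_congr_ae (Filter.Eventually.of_forall fun u => ?_)
  simp only [inner_smul_right]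
  ring

end Gaussian

/-! ### Variance of mini-batch averages -/

section Average

variable {Ω A H : Type*} [MeasurableSpace Ω] [MeasurableSpace A] [NormedAddCommGroup H]
  [InnerProductSpace ℝ H] [FiniteDimensional ℝ H] [MeasurableSpace H] [BorelSpace H]
  {Pr : Measure Ω} [IsProbabilityMeasure Pr]

omit [FiniteDimensional ℝ H] [MeasurableSpace H] [BorelSpace H] [IsProbabilityMeasure Pr] in
theorem integrable_inner_of_integrable_norm_sq {U V : Ω → H} (hU : AEStronglyMeasurable U Pr)
    (hV : AEStronglyMeasurable V Pr) (hU2 : Integrable (fun ω => ‖U ω‖ ^ 2) Pr)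
    (hV2 : Integrable (fun ω => ‖V ω‖ ^ 2) Pr) : Integrable (fun ω => ⟪U ω, V ω⟫_ℝ) Pr := by
  refine (hU2.add hV2).mono' (hU.inner hV) (Filter.Eventually.of_forall fun ω => ?_)
  have h1 := abs_real_inner_le_norm (U ω) (V ω)
  have h2 := two_mul_le_add_sq ‖U ω‖ ‖V ω‖
  have h3 := mul_nonneg (norm_nonneg (U ω)) (norm_nonneg (V ω))
  simp only [Pi.add_apply, Real.norm_eq_abs]
  linarith

omit [IsProbabilityMeasure Pr] in
/-- The mean squared error of the average of `m` pairwise independent centered vectors. -/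
theorem integral_norm_average_sq_le {m : ℕ} (hm : 1 ≤ m) {Z : ℕ → Ω → H} {v : ℝ}
    (hint : ∀ j, Integrable (Z j) Pr) (hsq : ∀ j, Integrable (fun ω => ‖Z j ω‖ ^ 2) Pr)
    (hmean : ∀ j, ∫ ω, Z j ω ∂Pr = 0) (hv : ∀ j, ∫ ω, ‖Z j ω‖ ^ 2 ∂Pr ≤ v)
    (hind : Pairwise fun i j => Z i ⟂ᵢ[Pr] Z j) :
    Integrable (fun ω => ‖(1 / (m : ℝ)) • ∑ j ∈ Finset.range m, Z j ω‖ ^ 2) Pr ∧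
      ∫ ω, ‖(1 / (m : ℝ)) • ∑ j ∈ Finset.range m, Z j ω‖ ^ 2 ∂Pr ≤ v / m := by
  have hin : ∀ i j, Integrable (fun ω => ⟪Z i ω, Z j ω⟫_ℝ) Pr := fun i j =>
    integrable_inner_of_integrable_norm_sq (hint i).1 (hint j).1 (hsq i) (hsq j)
  have hexp : ∀ ω, ‖(1 / (m : ℝ)) • ∑ j ∈ Finset.range m, Z j ω‖ ^ 2 =
      (1 / (m : ℝ)) ^ 2 * ∑ i ∈ Finset.range m, ∑ j ∈ Finset.range m, ⟪Z i ω, Z j ω⟫_ℝ := fun ω => by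
    rw [norm_smul, mul_pow, ← real_inner_self_eq_norm_sq (∑ j ∈ Finset.range m, Z j ω), sum_inner]
    simp [inner_sum]
  have hI : ∀ i ∈ Finset.range m, Integrable
      (fun ω => ∑ j ∈ Finset.range m, ⟪Z i ω, Z j ω⟫_ℝ) Pr := fun i _ =>
    integrable_finsetSum _ fun j _ => hin i j
  -- Independence factors the expected inner product into that of the means, which vanish; only the
  -- `m` diagonal terms remain.
  have hoff : ∀ i j, i ≠ j → ∫ ω, ⟪Z i ω, Z j ω⟫_ℝ ∂Pr = 0 := fun i j hij => by
    have := (hind hij).integral_bilin (hint i) (hint j) (innerSL ℝ)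
    simpa [hmean, innerSL_apply_apply ℝ] using this
  simp only [hexp]
  refine ⟨(integrable_finsetSum _ hI).const_mul _, ?_⟩
  rw [integral_const_mul, integral_finsetSum _ hI]
  have hrow : ∀ i ∈ Finset.range m, ∫ ω, ∑ j ∈ Finset.range m, ⟪Z i ω, Z j ω⟫_ℝ ∂Pr ≤ v :=
    fun i hi => by
      rw [integral_finsetSum _ fun j _ => hin i j, Finset.sum_eq_single_of_mem i hi
        fun j _ hji => hoff i j hji.symm]
      simpa only [real_inner_self_eq_norm_sq] using hv i
  have hm' : (0 : ℝ) < m := by exact_mod_cast hm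
  calc _ ≤ (1 / (m : ℝ)) ^ 2 * (m * v) := by
        refine mul_le_mul_of_nonneg_left ?_ (sq_nonneg _)
        simpa using Finset.sum_le_sum hrow
    _ = v / m := by field_simp

/-- The mean squared error of a mini-batch average of i.i.d. samples. -/
theorem integral_norm_average_sub_sq_le {ν : Measure A} [IsProbabilityMeasure ν] {S : ℕ → Ω → A}
    (hS : ∀ j, Measurable (S j)) (hlaw : ∀ j, Pr.map (S j) = ν)
    (hind : Pairwise fun i j => S i ⟂ᵢ[Pr] S j) {G : A → H} (hG : Measurable G) {v : ℝ} {g : H}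
    (hint : Integrable G ν) (hg : ∫ a, G a ∂ν = g) (hsq : Integrable (fun a => ‖G a - g‖ ^ 2) ν)
    (hv : ∫ a, ‖G a - g‖ ^ 2 ∂ν ≤ v) {m : ℕ} (hm : 1 ≤ m) :
    Integrable (fun ω => ‖(1 / (m : ℝ)) • ∑ j ∈ Finset.range m, G (S j ω) - g‖ ^ 2) Pr ∧
      ∫ ω, ‖(1 / (m : ℝ)) • ∑ j ∈ Finset.range m, G (S j ω) - g‖ ^ 2 ∂Pr ≤ v / m := by
  have hm' : (m : ℝ) ≠ 0 := by exact_mod_cast (by omega : m ≠ 0)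
  have hI : ∀ j, Integrable (fun ω => G (S j ω)) Pr := fun j => by
    have := hint
    rw [← hlaw j] at this
    exact this.comp_measurable (hS j)
  have h := integral_norm_average_sq_le (Pr := Pr) hm (Z := fun j ω => G (S j ω) - g) (v := v)
    (fun j => (hI j).sub (integrable_const _))
    (fun j => by
      have := hsq
      rw [← hlaw j] at this
      exact this.comp_measurable (hS j))
    (fun j => by
      rw [integral_sub (hI j) (integrable_const _), sub_eq_zero, integral_const, probReal_univ,
        one_smul, ← hg, ← hlaw j, integral_map (hS j).aemeasurable hG.aestronglyMeasurable])
    (fun j => by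
      rw [← hlaw j, integral_map (hS j).aemeasurable (by fun_prop)] at hv
      exact hv)
    (fun i j hij => (hind hij).comp (hG.sub_const g) (hG.sub_const g))
  have he : ∀ ω, (1 / (m : ℝ)) • ∑ j ∈ Finset.range m, (G (S j ω) - g) =
      (1 / (m : ℝ)) • ∑ j ∈ Finset.range m, G (S j ω) - g := fun ω => by
    rw [Finset.sum_sub_distrib, smul_sub, Finset.sum_const, Finset.card_range, ← Nat.cast_smul_eq_nsmul ℝ,
      smul_smul, one_div_mul_cancel hm', one_smul]
  simpa only [he] using h

end Average

/-! ### Measurability of gradients -/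

section MeasurableGradient

variable {d : ℕ} {A : Type*} [MeasurableSpace A]

/-- The gradient of a measurable function that is differentiable in its first variable is
measurable. -/
theorem measurable_gradient_with_param {φ : E d → A → ℝ}
    (hφ : Measurable (fun p : E d × A => φ p.1 p.2))
    (hd : ∀ a, Differentiable ℝ (fun x => φ x a)) :
    Measurable (fun p : E d × A => gradient (fun x => φ x p.2) p.1) := by
  have hcoord : ∀ i : Fin d, Measurable (fun p : E d × A => (gradient (fun x => φ x p.2) p.1) i) := by
    intro i
    -- Each coordinate of the gradient is the limit of the difference quotients with increment `1 /
    -- (n + 1)`.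
    refine measurable_of_tendsto_metrizable (f := fun (n : ℕ) (p : E d × A) =>
      ((n : ℝ) + 1) * (φ (p.1 + (1 / ((n : ℝ) + 1)) • EuclideanSpace.single i 1) p.2 - φ p.1 p.2))
      (fun n => ?_) ?_
    · refine Measurable.const_mul (Measurable.sub ?_ hφ) _
      exact hφ.comp ((measurable_fst.add_const _).prodMk measurable_snd)
    · rw [tendsto_pi_nhds]
      intro p
      have h1 : HasDerivAt (fun t : ℝ => φ (p.1 + t • EuclideanSpace.single i (1 : ℝ)) p.2)
          ⟪gradient (fun x => φ x p.2) p.1, EuclideanSpace.single i (1 : ℝ)⟫_ℝ 0 := by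
        have hl : HasDerivAt (fun t : ℝ => p.1 + t • (EuclideanSpace.single i (1 : ℝ) : E d))
            ((1 : ℝ) • EuclideanSpace.single i (1 : ℝ)) 0 :=
          ((hasDerivAt_id (0 : ℝ)).smul_const (EuclideanSpace.single i (1 : ℝ) : E d)).const_add p.1
        have hg : HasFDerivAt (fun x => φ x p.2)
            ((InnerProductSpace.toDual ℝ (E d)) (gradient (fun x => φ x p.2) p.1))
            (p.1 + (0 : ℝ) • EuclideanSpace.single i (1 : ℝ)) := by
          simpa using ((hd p.2) p.1).hasGradientAt.hasFDerivAt
        have h3 := hg.comp_hasDerivAt (0 : ℝ) hl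
        simp only [one_smul, InnerProductSpace.toDual_apply_apply] at h3
        exact h3
      have h2 : Filter.Tendsto (fun n : ℕ => 1 / ((n : ℝ) + 1)) Filter.atTop
          (nhdsWithin 0 (Set.Ioi 0)) :=
        tendsto_nhdsWithin_iff.2 ⟨tendsto_one_div_add_atTop_nhds_zero_nat,
          Filter.Eventually.of_forall fun n => Set.mem_Ioi.2 (by positivity)⟩
      have h3 := h1.tendsto_slope_zero_right.comp h2
      rw [real_inner_comm, inner_single_one] at h3
      refine h3.congr fun n => ?_
      simp
  exact (WithLp.measurable_toLp 2 (Fin d → ℝ)).comp (measurable_pi_iff.2 hcoord)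

variable {dX dY : ℕ} {Ξ : Type*} [MeasurableSpace Ξ] {P : Measure Ξ} {c : Constants}
  {X : Set (E dX)} {Y : Set (E dY)} {F : E dX → E dY → Ξ → ℝ} {σ : ℝ}

theorem RoundAssumptions.measurable_gradX (h : RoundAssumptions c P σ X Y F) :
    Measurable (fun p : (E dX × E dY) × Ξ => gradX (atNoise F p.2) p.1.1 p.1.2) := by
  have h1 := measurable_gradient_with_param (φ := fun x (a : E dY × Ξ) => F x a.1 a.2)
    h.measurable (fun a => (h.scc.contDiff_x a.2 a.1).differentiable (by norm_num))
  exact h1.comp (g := fun p : E dX × (E dY × Ξ) => gradient (fun x => F x p.2.1 p.2.2) p.1)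
    (f := fun p : (E dX × E dY) × Ξ => (p.1.1, (p.1.2, p.2))) (by fun_prop)

theorem RoundAssumptions.measurable_gradY (h : RoundAssumptions c P σ X Y F) :
    Measurable (fun p : (E dX × E dY) × Ξ => gradY (atNoise F p.2) p.1.1 p.1.2) := by
  have h1 := measurable_gradient_with_param (φ := fun y (a : E dX × Ξ) => F a.1 y a.2)
    (h.measurable.comp (f := fun p : E dY × (E dX × Ξ) => (p.2.1, (p.1, p.2.2))) (by fun_prop))
    (fun a => (h.scc.contDiff_y a.2 a.1).differentiable (by norm_num))
  exact h1.comp (g := fun p : E dY × (E dX × Ξ) => gradient (fun y => F p.2.1 y p.2.2) p.1)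
    (f := fun p : (E dX × E dY) × Ξ => (p.1.2, (p.1.1, p.2))) (by fun_prop)

variable [SFinite P]

theorem RoundAssumptions.measurable_meanGradX (h : RoundAssumptions c P σ X Y F) :
    Measurable (fun z : E dX × E dY => meanGradX P F z.1 z.2) :=
  (h.measurable_gradX.stronglyMeasurable.integral_prod_right (ν := P)).measurable

theorem RoundAssumptions.measurable_meanGradY (h : RoundAssumptions c P σ X Y F) :
    Measurable (fun z : E dX × E dY => meanGradY P F z.1 z.2) :=
  (h.measurable_gradY.stronglyMeasurable.integral_prod_right (ν := P)).measurable

theorem RoundAssumptions.measurable_mean (h : RoundAssumptions c P σ X Y F) :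
    Measurable (fun z : E dX × E dY => mean P F z.1 z.2) := by
  have h1 : Measurable (fun p : (E dX × E dY) × Ξ => F p.1.1 p.1.2 p.2) :=
    h.measurable.comp (f := fun p : (E dX × E dY) × Ξ => (p.1.1, (p.1.2, p.2))) (by fun_prop)
  exact (h1.stronglyMeasurable.integral_prod_right (ν := P)).measurable

theorem RoundAssumptions.measurable_sqError (h : RoundAssumptions c P σ X Y F) :
    Measurable (fun p : (E dX × E dY) × (E dX × E dY) => sqError P F p.1 p.2) := by
  have h1 := h.measurable_meanGradX.comp
    (measurable_fst : Measurable (Prod.fst : (E dX × E dY) × (E dX × E dY) → _))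
  have h2 := h.measurable_meanGradY.comp
    (measurable_fst : Measurable (Prod.fst : (E dX × E dY) × (E dX × E dY) → _))
  exact (((measurable_fst.comp measurable_snd).sub h1).norm.pow_const 2).add
    (((measurable_snd.comp measurable_snd).sub h2).norm.pow_const 2)

end MeasurableGradient

/-! ### Gaussian finite differences -/

section ZerothOrder

variable {Ω Ξ : Type*} [MeasurableSpace Ω] [MeasurableSpace Ξ] {Pr : Measure Ω}
  [IsProbabilityMeasure Pr] {P : Measure Ξ} [IsProbabilityMeasure P] {d : ℕ}

theorem norm_sub_sq_le_two (a b : E d) : ‖a - b‖ ^ 2 ≤ 2 * ‖a‖ ^ 2 + 2 * ‖b‖ ^ 2 := by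
  have h1 := norm_sub_le a b
  have h2 := sq_nonneg (‖a‖ - ‖b‖)
  nlinarith [norm_nonneg (a - b), norm_nonneg a, norm_nonneg b]

theorem norm_add_sq_le_two (a b : E d) : ‖a + b‖ ^ 2 ≤ 2 * ‖a‖ ^ 2 + 2 * ‖b‖ ^ 2 := by
  simpa using norm_sub_sq_le_two a (-b)

/-- Moments of `⟨D, u⟩ u` for a Gaussian `u` and an independent random vector `D`. -/
theorem inner_smul_moments {D : Ξ → E d} (hD : Measurable D) {g : E d} {σ B : ℝ}
    (hint : Integrable D P) (hg : ∫ ξ, D ξ ∂P = g) (hsq : Integrable (fun ξ => ‖D ξ - g‖ ^ 2) P)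
    (hσ : ∫ ξ, ‖D ξ - g‖ ^ 2 ∂P ≤ σ ^ 2) (hB : ‖g‖ ≤ B) :
    Integrable (fun a : E d × Ξ => ⟪D a.2, a.1⟫_ℝ • a.1) ((stdGaussian (E d)).prod P) ∧
    ∫ a, ⟪D a.2, a.1⟫_ℝ • a.1 ∂((stdGaussian (E d)).prod P) = g ∧
    Integrable (fun a : E d × Ξ => ‖⟪D a.2, a.1⟫_ℝ • a.1 - g‖ ^ 2) ((stdGaussian (E d)).prod P) ∧
    ∫ a, ‖⟪D a.2, a.1⟫_ℝ • a.1 - g‖ ^ 2 ∂((stdGaussian (E d)).prod P) ≤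
      4 * (d * gaussianMoment 4 + 1) * (σ ^ 2 + B ^ 2) := by
  have hDsq : Integrable (fun ξ => ‖D ξ‖ ^ 2) P := by
    refine ((hsq.const_mul 2).add (integrable_const (2 * ‖g‖ ^ 2))).mono' (by fun_prop)
      (Filter.Eventually.of_forall fun ξ => ?_)
    have := norm_add_sq_le_two (D ξ - g) g
    rw [sub_add_cancel] at this
    simpa using this
  have hDval : ∫ ξ, ‖D ξ‖ ^ 2 ∂P ≤ 2 * (σ ^ 2 + B ^ 2) := by
    calc _ ≤ ∫ ξ, (2 * ‖D ξ - g‖ ^ 2 + 2 * ‖g‖ ^ 2) ∂P := by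
          refine integral_mono hDsq ((hsq.const_mul 2).add (integrable_const _)) fun ξ => ?_
          have := norm_add_sq_le_two (D ξ - g) g
          rwa [sub_add_cancel] at this
      _ = 2 * ∫ ξ, ‖D ξ - g‖ ^ 2 ∂P + 2 * ‖g‖ ^ 2 := by
          rw [integral_add (hsq.const_mul 2) (integrable_const _), integral_const_mul]
          simp
      _ ≤ _ := by
          have := pow_le_pow_left₀ (norm_nonneg g) hB 2
          linarith
  have hmeas : Measurable (fun a : E d × Ξ => ⟪D a.2, a.1⟫_ℝ • a.1) := by fun_prop
  have hint1 : Integrable (fun a : E d × Ξ => ⟪D a.2, a.1⟫_ℝ • a.1) ((stdGaussian (E d)).prod P) := by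
    refine ((integrable_norm_pow_stdGaussian (d := d) 2).mul_prod hint.norm).mono'
      hmeas.aestronglyMeasurable (Filter.Eventually.of_forall fun a => ?_)
    rw [norm_smul, sq]
    have := abs_real_inner_le_norm (D a.2) a.1
    calc _ ≤ ‖D a.2‖ * ‖a.1‖ * ‖a.1‖ := mul_le_mul_of_nonneg_right this (norm_nonneg _)
      _ = _ := by ring
  have hint2 : Integrable (fun a : E d × Ξ => ⟪D a.2, a.1⟫_ℝ ^ 2 * ‖a.1‖ ^ 2)
      ((stdGaussian (E d)).prod P) := by
    refine ((integrable_norm_pow_stdGaussian (d := d) 4).mul_prod hDsq).mono'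
      (by fun_prop) (Filter.Eventually.of_forall fun a => ?_)
    rw [Real.norm_eq_abs, abs_of_nonneg (by positivity)]
    have : ⟪D a.2, a.1⟫_ℝ ^ 2 ≤ (‖D a.2‖ * ‖a.1‖) ^ 2 :=
      sq_le_sq' (neg_le_of_abs_le (abs_real_inner_le_norm _ _)) (real_inner_le_norm _ _)
    nlinarith [sq_nonneg ‖a.1‖]
  have hval2 : ∫ a, ⟪D a.2, a.1⟫_ℝ ^ 2 * ‖a.1‖ ^ 2 ∂((stdGaussian (E d)).prod P) ≤
      d * gaussianMoment 4 * (2 * (σ ^ 2 + B ^ 2)) := by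
    have h4 : 0 ≤ gaussianMoment 4 := gaussianMoment_nonneg (by decide)
    -- Integrating over `u` first, with `ξ` frozen, lets the Gaussian moment bound act on the fixed
    -- vector `D ξ`.
    rw [integral_prod_symm _ hint2]
    calc _ ≤ ∫ ξ, d * gaussianMoment 4 * ‖D ξ‖ ^ 2 ∂P :=
          integral_mono hint2.integral_prod_right (hDsq.const_mul _) fun ξ =>
            integral_inner_sq_mul_norm_sq_le (D ξ)
      _ ≤ _ := by
          rw [integral_const_mul]
          exact mul_le_mul_of_nonneg_left hDval (by positivity)
  have hle : ∀ a : E d × Ξ, ‖⟪D a.2, a.1⟫_ℝ • a.1 - g‖ ^ 2 ≤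
      2 * (⟪D a.2, a.1⟫_ℝ ^ 2 * ‖a.1‖ ^ 2) + 2 * ‖g‖ ^ 2 := fun a => by
    have := norm_sub_sq_le_two (⟪D a.2, a.1⟫_ℝ • a.1) g
    rwa [norm_smul, mul_pow, Real.norm_eq_abs, sq_abs] at this
  have hbd := (hint2.const_mul 2).add
    (integrable_const (μ := (stdGaussian (E d)).prod P) (2 * ‖g‖ ^ 2))
  have hint3 : Integrable (fun a : E d × Ξ => ‖⟪D a.2, a.1⟫_ℝ • a.1 - g‖ ^ 2)
      ((stdGaussian (E d)).prod P) :=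
    hbd.mono' (by fun_prop) (Filter.Eventually.of_forall fun a => by simpa using hle a)
  refine ⟨hint1, ?_, hint3, ?_⟩
  · rw [integral_prod_symm _ hint1]
    simp only [integral_inner_smul_stdGaussian, hg]
  · calc _ ≤ ∫ a, (2 * (⟪D a.2, a.1⟫_ℝ ^ 2 * ‖a.1‖ ^ 2) + 2 * ‖g‖ ^ 2)
          ∂((stdGaussian (E d)).prod P) := integral_mono hint3 hbd hle
      _ = 2 * ∫ a, ⟪D a.2, a.1⟫_ℝ ^ 2 * ‖a.1‖ ^ 2 ∂((stdGaussian (E d)).prod P) + 2 * ‖g‖ ^ 2 := by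
          rw [integral_add (hint2.const_mul 2) (integrable_const _), integral_const_mul]
          simp
      _ ≤ _ := by
          have := pow_le_pow_left₀ (norm_nonneg g) hB 2
          nlinarith [sq_nonneg σ, sq_nonneg B]

omit [IsProbabilityMeasure Pr] in
theorem lintegral_ofReal_le_of_ae_le {f h : Ω → ℝ} {b : ℝ} (hfh : ∀ᵐ ω ∂Pr, f ω ≤ h ω)
    (h0 : ∀ ω, 0 ≤ h ω) (hint : Integrable h Pr) (hb : ∫ ω, h ω ∂Pr ≤ b) :
    ∫⁻ ω, ENNReal.ofReal (f ω) ∂Pr ≤ ENNReal.ofReal b :=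
  calc _ ≤ ∫⁻ ω, ENNReal.ofReal (h ω) ∂Pr :=
        lintegral_mono_ae (hfh.mono fun _ => ENNReal.ofReal_le_ofReal)
    _ = ENNReal.ofReal (∫ ω, h ω ∂Pr) :=
        (ofReal_integral_eq_lintegral_ofReal hint (Filter.Eventually.of_forall h0)).symm
    _ ≤ _ := ENNReal.ofReal_le_ofReal hb

/-- The Gaussian finite difference differs from `⟨∇φ(x), u⟩ u` by at most `ν L ‖u‖³`. -/
theorem norm_finiteDifference_sub_le {φ : E d → ℝ} (hφ : Differentiable ℝ φ) {L ν : ℝ} (hL : 0 ≤ L)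
    (hν : 0 < ν) {x : E d} (hlip : ∀ z, ‖gradient φ z - gradient φ x‖ ≤ L * ‖z - x‖) (u : E d) :
    ‖((φ (x + ν • u) - φ x) / ν) • u - ⟪gradient φ x, u⟫_ℝ • u‖ ^ 2 ≤
      ν ^ 2 * L ^ 2 * ‖u‖ ^ 6 := by
  have h1 := abs_sub_sub_inner_le_sq convex_univ (φ := φ) (g := gradient φ)
    (fun z _ => (hφ z).hasGradientAt) hL (x := x) (x' := x + ν • u) (fun z _ => hlip z)
    (Set.mem_univ _) (Set.mem_univ _)
  rw [add_sub_cancel_left, inner_smul_right, norm_smul, Real.norm_eq_abs, abs_of_pos hν] at h1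
  have h2 : |(φ (x + ν • u) - φ x) / ν - ⟪gradient φ x, u⟫_ℝ| ≤ ν * L * ‖u‖ ^ 2 := by
    have : (φ (x + ν • u) - φ x) / ν - ⟪gradient φ x, u⟫_ℝ =
        (φ (x + ν • u) - φ x - ν * ⟪gradient φ x, u⟫_ℝ) / ν := by field_simp
    rw [this, abs_div, abs_of_pos hν, div_le_iff₀ hν]
    linarith
  rw [← sub_smul, norm_smul, Real.norm_eq_abs, mul_pow]
  calc _ ≤ (ν * L * ‖u‖ ^ 2) ^ 2 * ‖u‖ ^ 2 :=
        mul_le_mul_of_nonneg_right (pow_le_pow_left₀ (abs_nonneg _) h2 2) (sq_nonneg _)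
    _ = _ := by ring

/-- Mean squared error of the zeroth-order mini-batch estimator in one block of variables. -/
theorem lintegral_zerothOrder_le {φ : E d → Ξ → ℝ}
    (hd : ∀ ξ, Differentiable ℝ (fun x => φ x ξ)) {x : E d}
    (hD : Measurable (fun ξ => gradient (fun x => φ x ξ) x)) {L ν σ B : ℝ} (hL : 0 ≤ L) (hν : 0 < ν)
    (hlip : ∀ᵐ ξ ∂P, ∀ z, ‖gradient (fun x => φ x ξ) z - gradient (fun x => φ x ξ) x‖ ≤
      L * ‖z - x‖) {g : E d} (hint : Integrable (fun ξ => gradient (fun x => φ x ξ) x) P)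
    (hg : ∫ ξ, gradient (fun x => φ x ξ) x ∂P = g)
    (hsq : Integrable (fun ξ => ‖gradient (fun x => φ x ξ) x - g‖ ^ 2) P)
    (hσ : ∫ ξ, ‖gradient (fun x => φ x ξ) x - g‖ ^ 2 ∂P ≤ σ ^ 2) (hB : ‖g‖ ≤ B)
    {S : ℕ → Ω → E d × Ξ} (hS : ∀ j, Measurable (S j))
    (hlaw : ∀ j, Pr.map (S j) = (stdGaussian (E d)).prod P)
    (hind : Pairwise fun i j => S i ⟂ᵢ[Pr] S j) {m : ℕ} (hm : 1 ≤ m) :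
    ∫⁻ ω, ENNReal.ofReal (‖(1 / (m : ℝ)) • ∑ j ∈ Finset.range m,
      ((φ (x + ν • (S j ω).1) (S j ω).2 - φ x (S j ω).2) / ν) • (S j ω).1 - g‖ ^ 2) ∂Pr ≤
      ENNReal.ofReal (8 * (d * gaussianMoment 4 + 1) * (σ ^ 2 + B ^ 2) / m +
        2 * (ν ^ 2 * L ^ 2 * ((d : ℝ) ^ 3 * gaussianMoment 6))) := by
  set D := fun ξ => gradient (fun x => φ x ξ) x
  obtain ⟨k1, k2, k3, k4⟩ := inner_smul_moments hD hint hg hsq hσ hB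
  obtain ⟨a1, a2⟩ := integral_norm_average_sub_sq_le hS hlaw hind
    (G := fun a : E d × Ξ => ⟪D a.2, a.1⟫_ℝ • a.1) (by fun_prop) k1 k2 k3 k4 hm
  have hm' : (0 : ℝ) < m := by exact_mod_cast hm
  have hu : ∀ j, Integrable (fun ω => ‖(S j ω).1‖ ^ 6) Pr ∧
      ∫ ω, ‖(S j ω).1‖ ^ 6 ∂Pr ≤ (d : ℝ) ^ 3 * gaussianMoment 6 := fun j => by
    have hl : Pr.map (fun ω => (S j ω).1) = stdGaussian (E d) := by
      change Pr.map (Prod.fst ∘ S j) = _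
      rw [← Measure.map_map measurable_fst (hS j), hlaw j, Measure.map_fst_prod]
      simp
    have hmS : Measurable (fun ω => (S j ω).1) := measurable_fst.comp (hS j)
    have e1 := integrable_norm_pow_stdGaussian (d := d) 6
    have e2 := integral_norm_pow_six_stdGaussian_le (d := d)
    rw [← hl] at e1 e2
    rw [integral_map hmS.aemeasurable (by fun_prop)] at e2
    exact ⟨e1.comp_measurable hmS, e2⟩
  have hbound : Integrable (fun ω => 1 / (m : ℝ) * ∑ j ∈ Finset.range m,
      ν ^ 2 * L ^ 2 * ‖(S j ω).1‖ ^ 6) Pr :=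
    (integrable_finsetSum _ fun j _ => (hu j).1.const_mul _).const_mul _
  -- The exceptional null set of `P` is pulled back through the law of each sample. The bound is
  -- needed for every `z`, as the perturbed points are unbounded.
  have hae : ∀ᵐ ω ∂Pr, ∀ j, ∀ z, ‖gradient (fun x => φ x (S j ω).2) z - D (S j ω).2‖ ≤
      L * ‖z - x‖ := ae_all_iff.2 fun j => by
    have h2 : ∀ᵐ a ∂(Pr.map (S j)), ∀ z, ‖gradient (fun x => φ x a.2) z - D a.2‖ ≤
        L * ‖z - x‖ := by
      rw [hlaw j]
      exact Measure.quasiMeasurePreserving_snd.ae hlip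
    exact ae_of_ae_map (hS j).aemeasurable h2
  refine lintegral_ofReal_le_of_ae_le (h := fun ω =>
    2 * ‖(1 / (m : ℝ)) • ∑ j ∈ Finset.range m, ⟪D (S j ω).2, (S j ω).1⟫_ℝ • (S j ω).1 - g‖ ^ 2 +
    2 * (1 / (m : ℝ) * ∑ j ∈ Finset.range m, ν ^ 2 * L ^ 2 * ‖(S j ω).1‖ ^ 6)) ?_
    (fun ω => by positivity) ((a1.const_mul 2).add (hbound.const_mul 2)) ?_
  · filter_upwards [hae] with ω hω
    set R := fun j => ((φ (x + ν • (S j ω).1) (S j ω).2 - φ x (S j ω).2) / ν) • (S j ω).1 -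
      ⟪D (S j ω).2, (S j ω).1⟫_ℝ • (S j ω).1
    have hR : ∀ j, ‖R j‖ ^ 2 ≤ ν ^ 2 * L ^ 2 * ‖(S j ω).1‖ ^ 6 := fun j =>
      norm_finiteDifference_sub_le (hd _) hL hν (hω j) _
    -- Only the unbiased linear part profits from averaging; the remainders `R j` are bounded
    -- termwise, with their average controlled by Cauchy–Schwarz.
    have hdec : (1 / (m : ℝ)) • ∑ j ∈ Finset.range m,
        ((φ (x + ν • (S j ω).1) (S j ω).2 - φ x (S j ω).2) / ν) • (S j ω).1 - g =
        ((1 / (m : ℝ)) • ∑ j ∈ Finset.range m, ⟪D (S j ω).2, (S j ω).1⟫_ℝ • (S j ω).1 - g) +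
        (1 / (m : ℝ)) • ∑ j ∈ Finset.range m, R j := by
      simp only [R, Finset.sum_sub_distrib, smul_sub]
      abel
    rw [hdec]
    refine (norm_add_sq_le_two _ _).trans (add_le_add le_rfl ?_)
    refine mul_le_mul_of_nonneg_left ?_ zero_le_two
    have hn : ‖∑ j ∈ Finset.range m, R j‖ ^ 2 ≤ m * ∑ j ∈ Finset.range m, ‖R j‖ ^ 2 := by
      have h1 := pow_le_pow_left₀ (norm_nonneg _) (norm_sum_le (Finset.range m) R) 2
      have h2 := sq_sum_le_card_mul_sum_sq (s := Finset.range m) (f := fun j => ‖R j‖)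
      rw [Finset.card_range] at h2
      exact h1.trans h2
    rw [norm_smul, mul_pow, Real.norm_eq_abs, sq_abs]
    calc _ ≤ (1 / (m : ℝ)) ^ 2 * (m * ∑ j ∈ Finset.range m, ‖R j‖ ^ 2) :=
          mul_le_mul_of_nonneg_left hn (sq_nonneg _)
      _ = 1 / (m : ℝ) * ∑ j ∈ Finset.range m, ‖R j‖ ^ 2 := by field_simp
      _ ≤ _ := mul_le_mul_of_nonneg_left (Finset.sum_le_sum fun j _ => hR j) (by positivity)
  · rw [integral_add (a1.const_mul 2) (hbound.const_mul 2), integral_const_mul, integral_const_mul,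
      integral_const_mul, integral_finsetSum _ fun j _ => (hu j).1.const_mul _]
    refine add_le_add ?_ (mul_le_mul_of_nonneg_left ?_ zero_le_two)
    · calc _ ≤ 2 * (4 * (d * gaussianMoment 4 + 1) * (σ ^ 2 + B ^ 2) / m) :=
            mul_le_mul_of_nonneg_left a2 zero_le_two
        _ = _ := by ring
    · calc _ ≤ 1 / (m : ℝ) * ∑ j ∈ Finset.range m,
            ν ^ 2 * L ^ 2 * ((d : ℝ) ^ 3 * gaussianMoment 6) := by
            refine mul_le_mul_of_nonneg_left (Finset.sum_le_sum fun j _ => ?_) (by positivity)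
            rw [integral_const_mul]
            exact mul_le_mul_of_nonneg_left (hu j).2 (by positivity)
        _ = _ := by
            rw [Finset.sum_const, Finset.card_range, nsmul_eq_mul]
            field_simp

end ZerothOrder

/-! ### Independence of the rounds -/

section Independence

variable {Ω A : Type*} [MeasurableSpace Ω] [mA : MeasurableSpace A] {Pr : Measure Ω}
  [IsProbabilityMeasure Pr] {law : Measure A}

/-- Freezing: under independence the joint law is a product, so Tonelli reduces the bound to one for
each fixed value of `U`. With nonnegative integrals no integrability has to be known beforehand. -/
theorem lintegral_comp_le_of_indepFun {α β : Type*} [MeasurableSpace α] [MeasurableSpace β]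
    {U : Ω → α} {V : Ω → β} (hU : Measurable U) (hV : Measurable V) (hUV : U ⟂ᵢ[Pr] V)
    {φ : α × β → ENNReal} (hφ : Measurable φ) {b : ENNReal}
    (h : ∀ ω, ∫⁻ ω', φ (U ω, V ω') ∂Pr ≤ b) : ∫⁻ ω, φ (U ω, V ω) ∂Pr ≤ b := by
  have hmap := (indepFun_iff_map_prod_eq_prod_map_map hU.aemeasurable hV.aemeasurable).1 hUV
  have := Measure.isProbabilityMeasure_map (μ := Pr) hV.aemeasurable
  calc ∫⁻ ω, φ (U ω, V ω) ∂Pr = ∫⁻ p, φ p ∂(Pr.map fun ω => (U ω, V ω)) :=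
        (lintegral_map hφ (hU.prodMk hV)).symm
    _ = ∫⁻ ω, ∫⁻ v, φ (U ω, v) ∂(Pr.map V) ∂Pr := by
        rw [hmap, lintegral_prod _ hφ.aemeasurable, lintegral_map hφ.lintegral_prod_right' hU]
    _ = ∫⁻ ω, ∫⁻ ω', φ (U ω, V ω') ∂Pr ∂Pr :=
        lintegral_congr fun ω => lintegral_map (hφ.comp measurable_prodMk_left) hV
    _ ≤ ∫⁻ _, b ∂Pr := lintegral_mono h
    _ = b := by simp

/-- The information contained in the samples of the rounds `t` with `t ∈ R`. -/
abbrev roundsInfo (S : Ω → ℕ → ℕ → A) (R : Set ℕ) : MeasurableSpace Ω :=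
  ⨆ p ∈ {p : ℕ × ℕ | p.1 ∈ R}, MeasurableSpace.comap (fun ω => S ω p.1 p.2) mA

omit [MeasurableSpace Ω] in
theorem roundsInfo_mono (S : Ω → ℕ → ℕ → A) {R R' : Set ℕ} (h : R ⊆ R') :
    roundsInfo S R ≤ roundsInfo S R' :=
  biSup_mono fun _ hp => h hp

omit [MeasurableSpace Ω] in
theorem measurable_roundsInfo (S : Ω → ℕ → ℕ → A) {R : Set ℕ} {t : ℕ} (ht : t ∈ R) :
    Measurable[roundsInfo S R] (fun ω => S ω t) := by
  refine @measurable_pi_lambda _ _ _ (roundsInfo S R) _ _ fun j => ?_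
  refine Measurable.mono (comap_measurable _) ?_ le_rfl
  exact le_biSup (fun p : ℕ × ℕ => MeasurableSpace.comap (fun ω => S ω p.1 p.2) mA)
    (show (t, j) ∈ {p : ℕ × ℕ | p.1 ∈ R} from ht)

omit [IsProbabilityMeasure Pr] in
theorem IsIID.comap_le {S : Ω → ℕ → ℕ → A} (hS : IsIID Pr law (fun t j ω => S ω t j))
    (p : ℕ × ℕ) :
    MeasurableSpace.comap (fun ω => S ω p.1 p.2) mA ≤ (inferInstance : MeasurableSpace Ω) :=
  (hS.measurable p.1 p.2).comap_le

omit [IsProbabilityMeasure Pr] in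
theorem IsIID.roundsInfo_le {S : Ω → ℕ → ℕ → A} (hS : IsIID Pr law (fun t j ω => S ω t j))
    (R : Set ℕ) : roundsInfo S R ≤ (inferInstance : MeasurableSpace Ω) :=
  iSup₂_le fun p _ => hS.comap_le p

omit [IsProbabilityMeasure Pr] in
theorem IsIID.iIndep_comap {S : Ω → ℕ → ℕ → A} (hS : IsIID Pr law (fun t j ω => S ω t j)) :
    iIndep (fun p : ℕ × ℕ => MeasurableSpace.comap (fun ω => S ω p.1 p.2) mA) Pr :=
  (iIndepFun_iff_iIndep _ _ _).1 hS.indep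

omit [IsProbabilityMeasure Pr] in
theorem IsIID.indep_roundsInfo {S : Ω → ℕ → ℕ → A} (hS : IsIID Pr law (fun t j ω => S ω t j))
    {R R' : Set ℕ} (h : Disjoint R R') : Indep (roundsInfo S R) (roundsInfo S R') Pr := by
  have h2 : Disjoint {p : ℕ × ℕ | p.1 ∈ R} {p : ℕ × ℕ | p.1 ∈ R'} := by
    rw [Set.disjoint_left] at h ⊢
    exact fun p hp => h hp
  exact indep_iSup_of_disjoint hS.comap_le hS.iIndep_comap h2

omit [IsProbabilityMeasure Pr] in
theorem IsIID.pairwise_indepFun {S : Ω → ℕ → ℕ → A} (hS : IsIID Pr law (fun t j ω => S ω t j))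
    (t : ℕ) : Pairwise fun i j => (fun ω => S ω t i) ⟂ᵢ[Pr] (fun ω => S ω t j) := fun i j hij =>
  hS.indep.indepFun (i := (t, i)) (j := (t, j)) (by simpa using hij)

end Independence

/-! ### From the pathwise bound to the expected regret -/

section Expectation

variable {dX dY : ℕ} {Ω Ξ A : Type*} [MeasurableSpace Ω] [MeasurableSpace Ξ] [MeasurableSpace A]
  {Pr : Measure Ω} {P : Measure Ξ} {law : Measure A} {c : Constants} {X : Set (E dX)}
  {Y : Set (E dY)} {F : ℕ → E dX → E dY → Ξ → ℝ} {σ : ℝ}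
  {lmo : ℕ → E dX × E dY → E dX × E dY} {z₁ : E dX × E dY}
  {Est : ℕ → (ℕ → A) → E dX × E dY → (E dX × E dY) × ℕ} {T : ℕ}

omit [MeasurableSpace Ω] in
/-- The iterate after `n` rounds depends measurably on the samples of these rounds. -/
theorem measurable_fwState {γ : ℝ} (S : Ω → ℕ → ℕ → A) (hlmo : ∀ t, IsLMO X Y (lmo t))
    (hEst : ∀ t ∈ Finset.Icc 1 T,
      Measurable (fun p : (E dX × E dY) × (ℕ → A) => (Est t p.2 p.1).1)) {n : ℕ} (hn : n ≤ T) :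
    Measurable[roundsInfo S (Set.Iic n)]
      (fun ω => (fwState γ lmo (fun t => Est t (S ω t)) z₁ n).1) := by
  induction n with
  | zero => exact @measurable_const _ _ _ (roundsInfo S _) _
  | succ n ih =>
    have h1 := (ih (by omega)).mono
      (roundsInfo_mono S (Set.Iic_subset_Iic.2 (Nat.le_succ n))) le_rfl
    have h2 := measurable_roundsInfo S (R := Set.Iic (n + 1)) (t := n + 1) (Set.mem_Iic.2 le_rfl)
    have h3 := hEst (n + 1) (Finset.mem_Icc.2 ⟨by omega, hn⟩)
    have h4 : Measurable (fun p : (E dX × E dY) × (ℕ → A) => (1 - γ) • p.1 +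
        γ • lmo (n + 1) ((Est (n + 1) p.2 p.1).1.1, -(Est (n + 1) p.2 p.1).1.2)) := by
      have h6 := (hlmo (n + 1)).measurable.comp
        ((measurable_fst.comp h3).prodMk (measurable_snd.comp h3).neg)
      exact (measurable_fst.const_smul (1 - γ)).add (h6.const_smul γ)
    have h5 := h4.comp (h1.prodMk h2)
    exact h5

variable [IsProbabilityMeasure Pr] [IsProbabilityMeasure P]

/-- The expected regret of the Frank-Wolfe method whose gradient estimates are measurable functions
of fresh samples with mean squared error at most `Q / T`. -/
theorem integral_meritLoss_le (hc : c.Valid) (hC0 : 0 ≤ c.C0) (hT : 1 ≤ T) {M W : ℝ}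
    (hM : 0 < M) (hMT : M ≤ T) (hW : 2 * W ≤ M)
    (hF : ∀ t ∈ Finset.Icc 1 T, RoundAssumptions c P σ X Y (F t)) {xs : ℕ → E dX} {ys : ℕ → E dY}
    (hs : ∀ t ∈ Finset.Icc 1 T, InteriorSaddlePoint c X Y (mean P (F t)) (xs t) (ys t))
    (hvar : FunctionVariationLE T W X Y (fun t => mean P (F t)))
    (hlmo : ∀ t, IsLMO X Y (lmo t)) (hz : z₁ ∈ X ×ˢ Y) {S : Ω → ℕ → ℕ → A}
    (hS : IsIID Pr law (fun t j ω => S ω t j))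
    (hEst : ∀ t ∈ Finset.Icc 1 T,
      Measurable (fun p : (E dX × E dY) × (ℕ → A) => (Est t p.2 p.1).1)) {Q : ℝ} (hQ : 0 ≤ Q)
    (herr : ∀ t ∈ Finset.Icc 1 T, ∀ z ∈ X ×ˢ Y,
      ∫⁻ ω, ENNReal.ofReal (sqError P (F t) z (Est t (S ω t) z).1) ∂Pr ≤ ENNReal.ofReal (Q / T)) :
    Integrable (fun ω => meritLoss (fun t => mean P (F t)) xs ys T
      (played (stepSize T M) lmo (fun t => Est t (S ω t)) z₁)) Pr ∧
    ∫ ω, meritLoss (fun t => mean P (F t)) xs ys T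
      (played (stepSize T M) lmo (fun t => Est t (S ω t)) z₁) ∂Pr ≤
      c.pathConst / stepSize T M * (1 + M + Q) := by
  have hγ := stepSize_pos hT hM
  have hγ1 := stepSize_le_one hT hMT
  have hT' : (0 : ℝ) < T := by exact_mod_cast hT
  have h1T : 1 ∈ Finset.Icc 1 T := Finset.mem_Icc.2 ⟨le_rfl, hT⟩
  set Z : ℕ → Ω → E dX × E dY := fun t ω =>
    played (stepSize T M) lmo (fun t => Est t (S ω t)) z₁ t
  have hZmem : ∀ t ω, Z t ω ∈ X ×ˢ Y := fun t ω =>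
    played_mem (hF 1 h1T).convexX (hF 1 h1T).convexY hγ.le hγ1 hlmo hz t
  have hZinfo : ∀ t ∈ Finset.Icc 1 T, Measurable[roundsInfo S (Set.Iic (t - 1))] (Z t) :=
    fun t ht => measurable_fwState S hlmo hEst (by rw [Finset.mem_Icc] at ht; omega)
  have hZ : ∀ t ∈ Finset.Icc 1 T, Measurable (Z t) := fun t ht =>
    (hZinfo t ht).mono (hS.roundsInfo_le _) le_rfl
  have hSt : ∀ t, Measurable (fun ω => S ω t) := fun t => measurable_pi_iff.2 (hS.measurable t)
  set err : ℕ → Ω → ℝ := fun t ω => sqError P (F t) (Z t ω) (Est t (S ω t) (Z t ω)).1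
  -- The play of round `t` uses samples of rounds up to `t - 1` only, and distinct rounds have
  -- independent samples.
  have hind : ∀ t ∈ Finset.Icc 1 T, Z t ⟂ᵢ[Pr] (fun ω => S ω t) := fun t ht => by
    rw [Finset.mem_Icc] at ht
    have hd : Disjoint (Set.Iic (t - 1)) {t} :=
      Set.disjoint_singleton_right.2 (by rw [Set.mem_Iic]; omega)
    rw [IndepFun_iff_Indep]
    exact indep_of_indep_of_le_right (indep_of_indep_of_le_left (hS.indep_roundsInfo hd)
      (hZinfo t (Finset.mem_Icc.2 ht)).comap_le)
      (measurable_roundsInfo S (Set.mem_singleton t)).comap_le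
  have hφ : ∀ t ∈ Finset.Icc 1 T, Measurable (fun p : (E dX × E dY) × (ℕ → A) =>
      sqError P (F t) p.1 (Est t p.2 p.1).1) := fun t ht => by
    have h := (hF t ht).measurable_sqError.comp (measurable_fst.prodMk (hEst t ht))
    exact h
  have herr' : ∀ t ∈ Finset.Icc 1 T,
      ∫⁻ ω, ENNReal.ofReal (err t ω) ∂Pr ≤ ENNReal.ofReal (Q / T) := fun t ht => by
    have h := lintegral_comp_le_of_indepFun (hZ t ht) (hSt t) (hind t ht)
      (hφ t ht).ennreal_ofReal fun ω => herr t ht (Z t ω) (hZmem t ω)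
    exact h
  have herr0 : ∀ t ω, 0 ≤ err t ω := fun t ω => sqError_nonneg _ _ _
  have herrm : ∀ t ∈ Finset.Icc 1 T, Measurable (err t) := fun t ht => by
    have h := (hφ t ht).comp ((hZ t ht).prodMk (hSt t))
    exact h
  have herri : ∀ t ∈ Finset.Icc 1 T, Integrable (err t) Pr := fun t ht =>
    ⟨(herrm t ht).aestronglyMeasurable,
      (hasFiniteIntegral_iff_ofReal (Filter.Eventually.of_forall (herr0 t))).2
        ((herr' t ht).trans_lt ENNReal.ofReal_lt_top)⟩
  have herrv : ∀ t ∈ Finset.Icc 1 T, ∫ ω, err t ω ∂Pr ≤ Q / T := fun t ht => by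
    rw [integral_eq_lintegral_of_nonneg_ae (Filter.Eventually.of_forall (herr0 t))
      (herrm t ht).aestronglyMeasurable]
    exact ENNReal.toReal_le_of_le_ofReal (by positivity) (herr' t ht)
  have hpath : ∀ ω, meritLoss (fun t => mean P (F t)) xs ys T (fun t => Z t ω) ≤
      c.pathConst / stepSize T M * (1 + M + ∑ t ∈ Finset.Icc 1 T, err t ω) := fun ω =>
    meritLoss_le hc hC0 hT hM hMT hW hF hs hvar hlmo hz
  have hsumi : Integrable (fun ω => ∑ t ∈ Finset.Icc 1 T, err t ω) Pr :=
    integrable_finsetSum _ herri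
  have hbi : Integrable (fun ω => c.pathConst / stepSize T M *
      (1 + M + ∑ t ∈ Finset.Icc 1 T, err t ω)) Pr :=
    ((integrable_const (1 + M)).add hsumi).const_mul _
  have hmm : Measurable (fun ω => meritLoss (fun t => mean P (F t)) xs ys T (fun t => Z t ω)) :=
    Finset.measurable_sum _ fun t ht => by
      have h := (((hF t ht).measurable_mean.comp (hZ t ht)).sub_const
        (mean P (F t) (xs t) (ys t))).pow_const 2
      exact h
  -- The loss is nonnegative, measurable and dominated by the pathwise bound, itself integrable
  -- because the errors are.
  have hmi : Integrable (fun ω => meritLoss (fun t => mean P (F t)) xs ys T (fun t => Z t ω)) Pr := by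
    refine hbi.mono' hmm.aestronglyMeasurable (Filter.Eventually.of_forall fun ω => ?_)
    rw [Real.norm_eq_abs, abs_of_nonneg (Finset.sum_nonneg fun t _ => sq_nonneg _)]
    exact hpath ω
  refine ⟨hmi, (integral_mono hmi hbi hpath).trans ?_⟩
  have hK : 0 ≤ c.pathConst / stepSize T M := div_nonneg hc.pathConst_pos.le hγ.le
  rw [integral_const_mul, integral_add (integrable_const _) hsumi, integral_finsetSum _ herri]
  refine mul_le_mul_of_nonneg_left ?_ hK
  have hsum : ∑ t ∈ Finset.Icc 1 T, ∫ ω, err t ω ∂Pr ≤ Q := by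
    refine (Finset.sum_le_sum herrv).trans_eq ?_
    rw [Finset.sum_const, Nat.card_Icc, Nat.add_sub_cancel, nsmul_eq_mul]
    field_simp
  simpa using hsum

end Expectation

/-! ### The two gradient estimators: oracle calls and errors -/

section Estimators

variable {dX dY : ℕ} {Ξ : Type*}

theorem zoGradest_fst (F : E dX → E dY → Ξ → ℝ) (νX νY : ℝ) (mX mY : ℕ)
    (s : ℕ → (E dX × Ξ) × (E dY × Ξ)) (z : E dX × E dY) :
    (zoGradest F νX νY mX mY s z).1 =
      ((1 / (mX : ℝ)) • ∑ j ∈ Finset.range mX, ((F (z.1 + νX • (s j).1.1) z.2 (s j).1.2 -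
          F z.1 z.2 (s j).1.2) / νX) • (s j).1.1,
        (1 / (mY : ℝ)) • ∑ j ∈ Finset.range mY, ((F z.1 (z.2 + νY • (s j).2.1) (s j).2.2 -
          F z.1 z.2 (s j).2.2) / νY) • (s j).2.1) := by
  simp only [zoGradest, Prod.fst_sum, zoTermX, zoTermY, query]

theorem zoGradest_snd (F : E dX → E dY → Ξ → ℝ) (νX νY : ℝ) (mX mY : ℕ)
    (s : ℕ → (E dX × Ξ) × (E dY × Ξ)) (z : E dX × E dY) :
    (zoGradest F νX νY mX mY s z).2 = 2 * mX + 2 * mY := by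
  simp [zoGradest, Prod.snd_sum, zoTermX, zoTermY, query, mul_comm]

theorem foGradest_fst (F : E dX → E dY → Ξ → ℝ) (m : ℕ) (s : ℕ → Ξ) (z : E dX × E dY) :
    (foGradest F m s z).1 =
      ((1 / (m : ℝ)) • ∑ j ∈ Finset.range m, gradX (atNoise F (s j)) z.1 z.2,
        (1 / (m : ℝ)) • ∑ j ∈ Finset.range m, gradY (atNoise F (s j)) z.1 z.2) := by
  ext <;> simp [foGradest, Prod.fst_sum, Prod.snd_sum, gradQuery]

theorem fwState_snd_eq {γ : ℝ} {lmo : ℕ → E dX × E dY → E dX × E dY}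
    {est : ℕ → E dX × E dY → (E dX × E dY) × ℕ} {z₁ : E dX × E dY} {k : ℕ}
    (h : ∀ t z, (est t z).2 = k) (n : ℕ) : (fwState γ lmo est z₁ n).2 = n * k := by
  induction n with
  | zero => simp [fwState]
  | succ n ih => simp only [fwState, ih, h]; ring

/-- Two calls per term give `2T²(dX + dY + 10)` in all, and `dX + dY ≥ 2` turns this into the factor
`12`. -/
theorem zoEst_calls_le {T : ℕ} {γ : ℝ} {lmo : ℕ → E dX × E dY → E dX × E dY}
    {F : ℕ → E dX → E dY → Ξ → ℝ} {s : ℕ → ℕ → (E dX × Ξ) × (E dY × Ξ)} {z₁ : E dX × E dY}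
    (hX : 1 ≤ dX) (hY : 1 ≤ dY) :
    ((fwState γ lmo (zoEst T F s) z₁ T).2 : ℝ) ≤ 12 * (((dX : ℝ) + dY) * (T : ℝ) ^ 2) := by
  have h : ∀ t z, (zoEst T F s t z).2 = 2 * batchSize T dX + 2 * batchSize T dY := fun t z =>
    zoGradest_snd _ _ _ _ _ _ _
  rw [fwState_snd_eq h]
  have hX' : (1 : ℝ) ≤ dX := by exact_mod_cast hX
  have hY' : (1 : ℝ) ≤ dY := by exact_mod_cast hY
  simp only [batchSize]
  push_cast
  nlinarith [sq_nonneg (T : ℝ)]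

variable [MeasurableSpace Ξ] {P : Measure Ξ} {c : Constants} {X : Set (E dX)} {Y : Set (E dY)}
  {F : E dX → E dY → Ξ → ℝ} {σ : ℝ}

theorem RoundAssumptions.measurable_zoGradest (h : RoundAssumptions c P σ X Y F) (νX νY : ℝ)
    (mX mY : ℕ) : Measurable (fun p : (E dX × E dY) × (ℕ → (E dX × Ξ) × (E dY × Ξ)) =>
      (zoGradest F νX νY mX mY p.2 p.1).1) := by
  have hF : ∀ {f : (E dX × E dY) × (ℕ → (E dX × Ξ) × (E dY × Ξ)) → E dX × E dY × Ξ},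
      Measurable f → Measurable (fun p => F (f p).1 (f p).2.1 (f p).2.2) := fun hf =>
    h.measurable.comp hf
  simp only [zoGradest_fst]
  refine Measurable.prodMk ?_ ?_
  · refine (Finset.measurable_sum _ fun j _ => ?_).const_smul (1 / (mX : ℝ))
    have h1 := hF (f := fun p => (p.1.1 + νX • (p.2 j).1.1, p.1.2, (p.2 j).1.2)) (by fun_prop)
    have h2 := hF (f := fun p => (p.1.1, p.1.2, (p.2 j).1.2)) (by fun_prop)
    exact ((h1.sub h2).div_const νX).smul (by fun_prop)
  · refine (Finset.measurable_sum _ fun j _ => ?_).const_smul (1 / (mY : ℝ))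
    have h1 := hF (f := fun p => (p.1.1, p.1.2 + νY • (p.2 j).2.1, (p.2 j).2.2)) (by fun_prop)
    have h2 := hF (f := fun p => (p.1.1, p.1.2, (p.2 j).2.2)) (by fun_prop)
    exact ((h1.sub h2).div_const νY).smul (by fun_prop)

theorem RoundAssumptions.measurable_foGradest (h : RoundAssumptions c P σ X Y F) (m : ℕ) :
    Measurable (fun p : (E dX × E dY) × (ℕ → Ξ) => (foGradest F m p.2 p.1).1) := by
  simp only [foGradest_fst]
  refine Measurable.prodMk ?_ ?_
  · refine (Finset.measurable_sum _ fun j _ => ?_).const_smul (1 / (m : ℝ))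
    have h1 := h.measurable_gradX.comp
      (f := fun p : (E dX × E dY) × (ℕ → Ξ) => (p.1, p.2 j)) (by fun_prop)
    exact h1
  · refine (Finset.measurable_sum _ fun j _ => ?_).const_smul (1 / (m : ℝ))
    have h1 := h.measurable_gradY.comp
      (f := fun p : (E dX × E dY) × (ℕ → Ξ) => (p.1, p.2 j)) (by fun_prop)
    exact h1

/-- A bound for `‖∇ₓf‖`. -/
noncomputable def Constants.gradBoundX (c : Constants) : ℝ := c.LGX * c.DX + c.LXY * c.DY

/-- A bound for `‖∇_yf‖`. -/
noncomputable def Constants.gradBoundY (c : Constants) : ℝ := c.LGY * c.DY + c.LYX * c.DX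

/-- The constant in the mean squared error of the gradient estimators. -/
noncomputable def Constants.noiseConst (c : Constants) : ℝ :=
  16 * (gaussianMoment 4 + 1) * (1 + c.gradBoundX ^ 2 + c.gradBoundY ^ 2) +
    2 * (c.LGX ^ 2 + c.LGY ^ 2) * gaussianMoment 6

/-- The first-order estimator has error at most `2σ² / T`, so this lets one constant serve both
settings. -/
theorem Constants.two_le_noiseConst (c : Constants) : 2 ≤ c.noiseConst := by
  have h4 : 0 ≤ gaussianMoment 4 := gaussianMoment_nonneg (by decide)
  have h6 : 0 ≤ gaussianMoment 6 := gaussianMoment_nonneg (by decide)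
  have h7 : 0 ≤ 2 * (c.LGX ^ 2 + c.LGY ^ 2) * gaussianMoment 6 := by positivity
  have h8 : 0 ≤ gaussianMoment 4 * (1 + c.gradBoundX ^ 2 + c.gradBoundY ^ 2) := by positivity
  unfold Constants.noiseConst
  nlinarith [sq_nonneg c.gradBoundX, sq_nonneg c.gradBoundY]

/-- The error bound of the zeroth-order estimator for the batch size `T (d + 5)` and the smoothing
parameter `1 / √(T (d + 3)³)`. -/
theorem zerothOrder_parameters_le {T : ℕ} (hT : 1 ≤ T) (d : ℕ) {σ B L : ℝ} :
    8 * (d * gaussianMoment 4 + 1) * (σ ^ 2 + B ^ 2) / (batchSize T d : ℕ) +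
        2 * (smoothing T d ^ 2 * L ^ 2 * ((d : ℝ) ^ 3 * gaussianMoment 6)) ≤
      (8 * (gaussianMoment 4 + 1) * (σ ^ 2 + B ^ 2) + 2 * L ^ 2 * gaussianMoment 6) / T := by
  have h4 : 0 ≤ gaussianMoment 4 := gaussianMoment_nonneg (by decide)
  have h6 : 0 ≤ gaussianMoment 6 := gaussianMoment_nonneg (by decide)
  have hT' : (0 : ℝ) < T := by exact_mod_cast hT
  have hd : (0 : ℝ) ≤ d := Nat.cast_nonneg d
  rw [add_div]
  refine add_le_add ?_ ?_
  · simp only [batchSize]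
    push_cast
    rw [div_le_div_iff₀ (by positivity) hT']
    have : 8 * (d * gaussianMoment 4 + 1) * (σ ^ 2 + B ^ 2) ≤
        8 * (gaussianMoment 4 + 1) * (σ ^ 2 + B ^ 2) * (d + 5) := by
      have : (d * gaussianMoment 4 + 1) ≤ (gaussianMoment 4 + 1) * (d + 5) := by nlinarith
      nlinarith [sq_nonneg σ, sq_nonneg B]
    nlinarith
  · rw [smoothing, div_pow, Real.sq_sqrt (by positivity), one_pow, le_div_iff₀ hT']
    have h3 : (d : ℝ) ^ 3 ≤ ((d : ℝ) + 3) ^ 3 := pow_le_pow_left₀ hd (by linarith) 3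
    have h5 : (d : ℝ) ^ 3 / ((d : ℝ) + 3) ^ 3 ≤ 1 := (div_le_one (by positivity)).2 h3
    calc _ = 2 * L ^ 2 * gaussianMoment 6 * ((d : ℝ) ^ 3 / ((d : ℝ) + 3) ^ 3) := by field_simp
      _ ≤ _ := mul_le_of_le_one_right (by positivity) h5

variable {Ω : Type*} [MeasurableSpace Ω] {Pr : Measure Ω} [IsProbabilityMeasure Pr]
  [IsProbabilityMeasure P] {xs : E dX} {ys : E dY}

omit [IsProbabilityMeasure Pr] [IsProbabilityMeasure P] in
theorem lintegral_sqError_le {z : E dX × E dY} {G : Ω → E dX × E dY} (hG : Measurable G)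
    {b₁ b₂ : ℝ} (hb₁ : 0 ≤ b₁) (hb₂ : 0 ≤ b₂)
    (h₁ : ∫⁻ ω, ENNReal.ofReal (‖(G ω).1 - meanGradX P F z.1 z.2‖ ^ 2) ∂Pr ≤ ENNReal.ofReal b₁)
    (h₂ : ∫⁻ ω, ENNReal.ofReal (‖(G ω).2 - meanGradY P F z.1 z.2‖ ^ 2) ∂Pr ≤ ENNReal.ofReal b₂) :
    ∫⁻ ω, ENNReal.ofReal (sqError P F z (G ω)) ∂Pr ≤ ENNReal.ofReal (b₁ + b₂) := by
  have he : ∀ ω, ENNReal.ofReal (sqError P F z (G ω)) =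
      ENNReal.ofReal (‖(G ω).1 - meanGradX P F z.1 z.2‖ ^ 2) +
      ENNReal.ofReal (‖(G ω).2 - meanGradY P F z.1 z.2‖ ^ 2) := fun ω =>
    ENNReal.ofReal_add (sq_nonneg _) (sq_nonneg _)
  simp only [he]
  rw [lintegral_add_left (by fun_prop), ENNReal.ofReal_add hb₁ hb₂]
  exact add_le_add h₁ h₂

theorem RoundAssumptions.lintegral_zoGradest_le (h : RoundAssumptions c P σ X Y F)
    (hs : InteriorSaddlePoint c X Y (mean P F) xs ys) {T : ℕ} (hT : 1 ≤ T)
    {S : Ω → ℕ → ℕ → (E dX × Ξ) × (E dY × Ξ)}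
    (hS : IsIID Pr (zoLaw dX dY P) (fun t j ω => S ω t j)) (t : ℕ) {z : E dX × E dY}
    (hz : z ∈ X ×ˢ Y) :
    ∫⁻ ω, ENNReal.ofReal (sqError P F z (zoGradest F (smoothing T dX) (smoothing T dY)
      (batchSize T dX) (batchSize T dY) (S ω t) z).1) ∂Pr ≤
      ENNReal.ofReal (c.noiseConst * (1 + σ ^ 2) / T) := by
  have hT' : (0 : ℝ) < T := by exact_mod_cast hT
  have h4 : 0 ≤ gaussianMoment 4 := gaussianMoment_nonneg (by decide)
  have h6 : 0 ≤ gaussianMoment 6 := gaussianMoment_nonneg (by decide)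
  have hν : ∀ d, 0 < smoothing T d := fun d => by
    unfold smoothing
    positivity
  have hm : ∀ d, 1 ≤ batchSize T d := fun d => Nat.mul_pos hT (by omega)
  have hSm : Measurable (fun ω => (z, S ω t)) :=
    measurable_const.prodMk (measurable_pi_iff.2 (hS.measurable t))
  have hGm := (h.measurable_zoGradest (smoothing T dX) (smoothing T dY) (batchSize T dX)
    (batchSize T dY)).comp hSm
  have hpair := hS.pairwise_indepFun t
  have hlawX : ∀ j, Pr.map (fun ω => (S ω t j).1) = (stdGaussian (E dX)).prod P := fun j => by
    change Pr.map (Prod.fst ∘ fun ω => S ω t j) = _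
    rw [← Measure.map_map measurable_fst (hS.measurable t j), hS.law_eq t j, zoLaw,
      Measure.map_fst_prod]
    simp
  have hlawY : ∀ j, Pr.map (fun ω => (S ω t j).2) = (stdGaussian (E dY)).prod P := fun j => by
    change Pr.map (Prod.snd ∘ fun ω => S ω t j) = _
    rw [← Measure.map_map measurable_snd (hS.measurable t j), hS.law_eq t j, zoLaw,
      Measure.map_snd_prod]
    simp
  have hvX := h.oracle.variance_x z.1 hz.1 z.2 hz.2
  have hvY := h.oracle.variance_y z.1 hz.1 z.2 hz.2
  rw [h.oracle.gradX_mean hz.1 hz.2] at hvX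
  rw [h.oracle.gradY_mean hz.1 hz.2] at hvY
  have hDX := h.measurable_gradX.comp (measurable_prodMk_left (x := z))
  have hDY := h.measurable_gradY.comp (measurable_prodMk_left (x := z))
  have eX := lintegral_zerothOrder_le (Pr := Pr) (P := P) (φ := fun x ξ => F x z.2 ξ)
    (fun ξ => (h.scc.contDiff_x ξ z.2).differentiable (by norm_num)) (x := z.1) hDX
    h.valid.LGX_nonneg (hν dX)
    (h.lipGrad.mono fun ξ k z' => k.1 z' z.1 z.2 hz.2)
    (g := meanGradX P F z.1 z.2) (h.oracle.integrable_gradX z.1 hz.1 z.2 hz.2) rfl hvX.1 hvX.2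
    (B := c.gradBoundX) (hs.norm_meanGradX_le h hz.1 hz.2)
    (fun j => measurable_fst.comp (hS.measurable t j)) hlawX
    (fun i j hij => (hpair hij).comp measurable_fst measurable_fst) (hm dX)
  have eY := lintegral_zerothOrder_le (Pr := Pr) (P := P) (φ := fun y ξ => F z.1 y ξ)
    (fun ξ => (h.scc.contDiff_y ξ z.1).differentiable (by norm_num)) (x := z.2) hDY
    h.valid.LGY_nonneg (hν dY)
    (h.lipGrad.mono fun ξ k z' => k.2 z.1 hz.1 z' z.2)
    (g := meanGradY P F z.1 z.2) (h.oracle.integrable_gradY z.1 hz.1 z.2 hz.2) rfl hvY.1 hvY.2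
    (B := c.gradBoundY) (hs.norm_meanGradY_le h hz.1 hz.2)
    (fun j => measurable_snd.comp (hS.measurable t j)) hlawY
    (fun i j hij => (hpair hij).comp measurable_snd measurable_snd) (hm dY)
  have fX := eX.trans (ENNReal.ofReal_le_ofReal (zerothOrder_parameters_le hT dX))
  have fY := eY.trans (ENNReal.ofReal_le_ofReal (zerothOrder_parameters_le hT dY))
  have key := lintegral_sqError_le (P := P) (F := F) (z := z) hGm
    (b₁ := (8 * (gaussianMoment 4 + 1) * (σ ^ 2 + c.gradBoundX ^ 2) +
      2 * c.LGX ^ 2 * gaussianMoment 6) / T)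
    (b₂ := (8 * (gaussianMoment 4 + 1) * (σ ^ 2 + c.gradBoundY ^ 2) +
      2 * c.LGY ^ 2 * gaussianMoment 6) / T) (by positivity) (by positivity)
    (by simpa only [Function.comp_apply, zoGradest_fst] using fX)
    (by simpa only [Function.comp_apply, zoGradest_fst] using fY)
  refine key.trans (ENNReal.ofReal_le_ofReal ?_)
  rw [← add_div]
  refine div_le_div_of_nonneg_right ?_ hT'.le
  have k1 : 0 ≤ (gaussianMoment 4 + 1) * (1 + (c.gradBoundX ^ 2 + c.gradBoundY ^ 2) * σ ^ 2) := by
    positivity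
  have k2 : 0 ≤ (gaussianMoment 4 + 1) * (c.gradBoundX ^ 2 + c.gradBoundY ^ 2) := by positivity
  have k3 : 0 ≤ (c.LGX ^ 2 + c.LGY ^ 2) * gaussianMoment 6 * σ ^ 2 := by positivity
  unfold Constants.noiseConst
  linarith

theorem RoundAssumptions.lintegral_foGradest_le (h : RoundAssumptions c P σ X Y F) {T : ℕ}
    (hT : 1 ≤ T) {S : Ω → ℕ → ℕ → Ξ} (hS : IsIID Pr P (fun t j ω => S ω t j)) (t : ℕ)
    {z : E dX × E dY} (hz : z ∈ X ×ˢ Y) :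
    ∫⁻ ω, ENNReal.ofReal (sqError P F z (foGradest F T (S ω t) z).1) ∂Pr ≤
      ENNReal.ofReal (c.noiseConst * (1 + σ ^ 2) / T) := by
  have hT' : (0 : ℝ) < T := by exact_mod_cast hT
  have hSm : Measurable (fun ω => (z, S ω t)) :=
    measurable_const.prodMk (measurable_pi_iff.2 (hS.measurable t))
  have hGm := (h.measurable_foGradest T).comp hSm
  have hpair := hS.pairwise_indepFun t
  have hvX := h.oracle.variance_x z.1 hz.1 z.2 hz.2
  have hvY := h.oracle.variance_y z.1 hz.1 z.2 hz.2
  rw [h.oracle.gradX_mean hz.1 hz.2] at hvX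
  rw [h.oracle.gradY_mean hz.1 hz.2] at hvY
  have hDX := h.measurable_gradX.comp (measurable_prodMk_left (x := z))
  have hDY := h.measurable_gradY.comp (measurable_prodMk_left (x := z))
  obtain ⟨iX, eX⟩ := integral_norm_average_sub_sq_le (hS.measurable t) (hS.law_eq t) hpair hDX
    (g := meanGradX P F z.1 z.2) (h.oracle.integrable_gradX z.1 hz.1 z.2 hz.2) rfl hvX.1 hvX.2 hT
  obtain ⟨iY, eY⟩ := integral_norm_average_sub_sq_le (hS.measurable t) (hS.law_eq t) hpair hDY
    (g := meanGradY P F z.1 z.2) (h.oracle.integrable_gradY z.1 hz.1 z.2 hz.2) rfl hvY.1 hvY.2 hT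
  have fX := lintegral_ofReal_le_of_ae_le (Filter.Eventually.of_forall fun _ => le_rfl)
    (fun _ => sq_nonneg _) iX eX
  have fY := lintegral_ofReal_le_of_ae_le (Filter.Eventually.of_forall fun _ => le_rfl)
    (fun _ => sq_nonneg _) iY eY
  have key := lintegral_sqError_le (P := P) (F := F) (z := z) hGm (b₁ := σ ^ 2 / T)
    (b₂ := σ ^ 2 / T) (by positivity) (by positivity)
    (by simpa only [Function.comp_apply, foGradest_fst] using fX)
    (by simpa only [Function.comp_apply, foGradest_fst] using fY)
  refine key.trans (ENNReal.ofReal_le_ofReal ?_)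
  rw [← add_div]
  refine div_le_div_of_nonneg_right ?_ hT'.le
  nlinarith [c.two_le_noiseConst, sq_nonneg σ]

end Estimators

/-! ### The final rate -/

section Rate

/-- The constant of the regret bounds. -/
noncomputable def Constants.regretConst (c : Constants) (κ : ℝ) : ℝ :=
  12 + c.pathConst * ((1 + c.noiseConst) * (1 / κ + 1))

theorem Constants.Valid.regretConst_ge {c : Constants} (hc : c.Valid) {κ : ℝ} (hκ : 0 < κ) :
    12 ≤ c.regretConst κ := by
  have h1 := hc.pathConst_pos
  have h2 := c.two_le_noiseConst
  unfold Constants.regretConst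
  have : 0 ≤ c.pathConst * ((1 + c.noiseConst) * (1 / κ + 1)) := by positivity
  linarith

/-- For this step size `√(T M) = M / γ`, which is the form the pathwise bound produces. -/
theorem regretRate_eq {T : ℕ} (hT : 1 ≤ T) {M σ : ℝ} (hM : 0 < M) :
    regretRate T M σ = (M + σ ^ 2) / stepSize T M := by
  have hT' : (0 : ℝ) < T := by exact_mod_cast hT
  have h1 : √((T : ℝ) * M) = M / stepSize T M := by
    rw [eq_div_iff (stepSize_pos hT hM).ne', stepSize, ← Real.sqrt_mul (by positivity)]
    have : (T : ℝ) * M * (M / T) = M ^ 2 := by field_simp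
    rw [this, Real.sqrt_sq hM.le]
  rw [regretRate, h1]
  field_simp

theorem Constants.Valid.pathConst_mul_le {c : Constants} (hc : c.Valid) {κ : ℝ} (hκ : 0 < κ) {T : ℕ}
    (hT : 1 ≤ T) {M σ : ℝ} (hM : 0 < M) (hκM : κ ≤ M + σ ^ 2) :
    c.pathConst / stepSize T M * (1 + M + c.noiseConst * (1 + σ ^ 2)) ≤
      c.regretConst κ * regretRate T M σ := by
  have hγ := stepSize_pos hT hM
  have h1 := hc.pathConst_pos
  have h2 := c.two_le_noiseConst
  have h3 : 1 + M + σ ^ 2 ≤ (1 / κ + 1) * (M + σ ^ 2) := by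
    -- The constant contribution of the initial gap and of the noise-free estimator error is
    -- absorbed by `κ ≤ M + σ²`.
    have : 1 ≤ 1 / κ * (M + σ ^ 2) := by
      rw [one_div, inv_mul_eq_div, le_div_iff₀ hκ, one_mul]
      exact hκM
    linarith
  have h4 : 1 + M + c.noiseConst * (1 + σ ^ 2) ≤
      (1 + c.noiseConst) * ((1 / κ + 1) * (M + σ ^ 2)) := by
    have h5 : 1 + M + c.noiseConst * (1 + σ ^ 2) ≤ (1 + c.noiseConst) * (1 + M + σ ^ 2) := by
      nlinarith [sq_nonneg σ]
    exact h5.trans (mul_le_mul_of_nonneg_left h3 (by linarith))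
  rw [regretRate_eq hT hM]
  calc _ ≤ c.pathConst / stepSize T M * ((1 + c.noiseConst) * ((1 / κ + 1) * (M + σ ^ 2))) :=
        mul_le_mul_of_nonneg_left h4 (by positivity)
    _ = c.pathConst * ((1 + c.noiseConst) * (1 / κ + 1)) * ((M + σ ^ 2) / stepSize T M) := by ring
    _ ≤ _ := mul_le_mul_of_nonneg_right (by unfold Constants.regretConst; linarith) (by positivity)

end Rate

end OnlineSaddle

theorem mainTheorem4 (c : Constants) (hc : c.Valid) (hC0 : 0 ≤ c.C0 ∧ c.C0 ≤ 1)
    (κ : ℝ) (hκ : 0 < κ) :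
    -- the constant depends on the problem constants and on `κ` only
    ∃ C : ℝ, 0 < C ∧
      ∀ (dX dY : ℕ) (_ : 1 ≤ dX) (_ : 1 ≤ dY)
        (X : Set (E dX)) (Y : Set (E dY))
        (_ : IsCompact X) (_ : Convex ℝ X) (_ : IsCompact Y) (_ : Convex ℝ Y)
        (_ : ∀ x ∈ X, ∀ x' ∈ X, ‖x - x'‖ ≤ c.DX) (_ : ∀ y ∈ Y, ∀ y' ∈ Y, ‖y - y'‖ ≤ c.DY)
        -- the horizon, the noise level and the variation budgets
        (T : ℕ) (_ : 1 ≤ T) (σ V W : ℝ) (_ : 0 ≤ σ) (_ : 0 ≤ V) (_ : 0 ≤ W)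
        (_ : 0 < max (2 * W) V) (_ : max (2 * W) V ≤ T) (_ : κ ≤ max (2 * W) V + σ ^ 2)
        -- the stochastic functions `F_t`, with means `f_t = mean P (F t)`
        (Ξ : Type*) [MeasurableSpace Ξ] (P : Measure Ξ) [IsProbabilityMeasure P]
        (F : ℕ → E dX → E dY → Ξ → ℝ)
        (_ : ∀ t ∈ Finset.Icc 1 T,
          Measurable (fun p : E dX × E dY × Ξ => F t p.1 p.2.1 p.2.2) ∧
          StronglyConvexConcave c X Y (F t) ∧
          LipschitzFunction c P X Y (F t) ∧
          LipschitzGradient c P X Y (F t) ∧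
          LipschitzPartialGradient c P X Y (F t) ∧
          StochasticOracle P σ X Y (F t))
        (xs : ℕ → E dX) (ys : ℕ → E dY)
        (_ : ∀ t ∈ Finset.Icc 1 T, InteriorSaddlePoint c X Y (mean P (F t)) (xs t) (ys t))
        (_ : PathVariationLE T V xs ys)
        (_ : FunctionVariationLE T W X Y (fun t => mean P (F t)))
        -- the linear minimization oracle and the initial point
        (lmo : ℕ → E dX × E dY → E dX × E dY) (_ : ∀ t, IsLMO X Y (lmo t))
        (z₁ : E dX × E dY) (_ : z₁ ∈ X ×ˢ Y)
        (Ω : Type*) [MeasurableSpace Ω] (Pr : Measure Ω) [IsProbabilityMeasure Pr],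
        -- the zeroth-order setting
        (∀ S : Ω → ℕ → ℕ → (E dX × Ξ) × (E dY × Ξ),
          IsIID Pr (zoLaw dX dY P) (fun t j ω => S ω t j) →
          Integrable (fun ω => meritLoss (fun t => mean P (F t)) xs ys T
            (played (stepSize T (max (2 * W) V)) lmo (zoEst T F (S ω)) z₁)) Pr ∧
          ∫ ω, meritLoss (fun t => mean P (F t)) xs ys T
            (played (stepSize T (max (2 * W) V)) lmo (zoEst T F (S ω)) z₁) ∂Pr
              ≤ C * regretRate T (max (2 * W) V) σ ∧
          ∀ ω, ((fwState (stepSize T (max (2 * W) V)) lmo (zoEst T F (S ω)) z₁ T).2 : ℝ)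
              ≤ C * (((dX : ℝ) + dY) * (T : ℝ) ^ 2)) ∧
        -- the first-order setting
        (∀ S : Ω → ℕ → ℕ → Ξ, IsIID Pr P (fun t j ω => S ω t j) →
          Integrable (fun ω => meritLoss (fun t => mean P (F t)) xs ys T
            (played (stepSize T (max (2 * W) V)) lmo (foEst T F (S ω)) z₁)) Pr ∧
          ∫ ω, meritLoss (fun t => mean P (F t)) xs ys T
            (played (stepSize T (max (2 * W) V)) lmo (foEst T F (S ω)) z₁) ∂Pr
              ≤ C * regretRate T (max (2 * W) V) σ) := by
  -- The summand `12` of `regretConst` covers the number of oracle calls, the other summand the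
  -- regret.
  refine ⟨c.regretConst κ, by linarith [hc.regretConst_ge hκ], ?_⟩
  intro dX dY hdX hdY X Y hXc hX hYc hY hDX hDY T hT σ V W _ _ _ hM hMT hκM Ξ _ P _ F hF xs ys hs _
    hvar lmo hlmo z₁ hz Ω _ Pr _
  have hround : ∀ t ∈ Finset.Icc 1 T, RoundAssumptions c P σ X Y (F t) := fun t ht => by
    obtain ⟨h1, h2, h3, h4, h5, h6⟩ := hF t ht
    exact ⟨hc, hXc, hX, hYc, hY, hDX, hDY, h1, h2, h3, h4, h5, h6⟩
  have hQ : 0 ≤ c.noiseConst * (1 + σ ^ 2) := by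
    have := c.two_le_noiseConst
    positivity
  have hrate := hc.pathConst_mul_le hκ hT hM hκM
  constructor
  · intro S hS
    obtain ⟨h1, h2⟩ := integral_meritLoss_le (Pr := Pr)
      (Est := fun t s => zoGradest (F t) (smoothing T dX) (smoothing T dY) (batchSize T dX)
        (batchSize T dY) s) hc hC0.1 hT hM hMT (le_max_left _ _) hround hs hvar hlmo hz hS
      (fun t ht => (hround t ht).measurable_zoGradest _ _ _ _) hQ
      (fun t ht z hz' => (hround t ht).lintegral_zoGradest_le (hs t ht) hT hS t hz')
    exact ⟨h1, h2.trans hrate, fun ω => (zoEst_calls_le hdX hdY).trans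
      (mul_le_mul_of_nonneg_right (hc.regretConst_ge hκ) (by positivity))⟩
  · intro S hS
    obtain ⟨h1, h2⟩ := integral_meritLoss_le (Pr := Pr)
      (Est := fun t s => foGradest (F t) T s) hc hC0.1 hT hM hMT (le_max_left _ _) hround hs hvar
      hlmo hz hS (fun t ht => (hround t ht).measurable_foGradest T) hQ
      (fun t ht z hz' => (hround t ht).lintegral_foGradest_le hT hS t hz')
    exact ⟨h1, h2.trans hrate⟩
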